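/- Let $X$ be a real separable Banach space with dual $X^*$ and duality $\langle\cdot,\cdot\rangle$. Assume the following. (1) $Q:X^*\to X$ is linear, bounded, symmetric ($\langle Qx^*,y^*\rangle=\langle Qy^*,x^*\rangle$) and nonnegative ($\langle Qx^*,x^*\rangle\ge 0$). $A:D(A)\subseteq X\to X$ is the infinitesimal generator of a strongly continuous contraction semigroup $(e^{tA})_{t\ge0}$, and $A^*:D(A^*)\subseteq X^*\to X^*$ is its adjoint. $H$ is the reproducing kernel Hilbert space of $Q$, i.e. the completion of $QX^*$ for $[Qx^*,Qy^*]_H=\langle Qx^*,y^*\rangle$, continuously embedded in $X$ by $i:H\to X$; $i^*:X^*\to H$ sends $x^*$ to the element $Qx^*$ of $H$, so that $Q=i\circ i^*$. (2) For $t>0$ the operator $Q_tx^*=\int_0^te^{sA}Qe^{sA^*}x^*\,ds$ is the covariance operator of a centred Gaussian measure on $X$; for all $x^*\in X^*$ the weak limit $Q_\infty x^*$ of $Q_tx^*$ as $t\to+\infty$ exists, and $Q_\infty$ is the covariance operator of a centred nondegenerate Gaussian measure $\mu_\infty$ on $X$. (3) There is $c>0$ such that for every $x^*\in D(A^*)$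 we have $Q_\infty A^*x^*\in H$ and $|Q_\infty A^*x^*|_H\le c\,|i^*x^*|_H$. Let $B$ be the bounded linear operator on $H$ with $Bi^*x^*=Q_\infty A^*x^*$ for all $x^*\in D(A^*)$. Let $C_b^k(\mathbb R^n)$ be the space of functions that are continuous and bounded together with their derivatives up to order $k$. Let $\mathscr{FC}_b^1(X)$ be the set of functions $f(x)=\varphi(\langle x,x_1^*\rangle,\dots,\langle x,x_n^*\rangle)$ with $n\in\mathbb N$, $\varphi\in C_b^1(\mathbb R^n)$, $x_i^*\in X^*$, and let $\mathscr{FC}_b^{2,1}(X)$ be the set of such functions with $\varphi\in C_b^2(\mathbb R^n)$ and $x_i^*\in D(A^*)$. On $\mathscr{FC}_b^1(X)$ set $D_Hf(x)=i^*Df(x)$. For a Borel measure $\gamma$ on $X$, $W^{1,p}_H(X,\gamma)$ is the domain of the closure (still denoted $D_H$) of $D_H:\mathscr{FC}_b^1(X)\to L^p(X,\gamma;H)$ in $L^p(X,\gamma)$. (4) $U:X\to(-\infty,+\infty]$ is proper, convex, lower semicontinuous, and $U\in W^{1,p}_H(X,\mu_\infty)$ for all $p\in[1,+\infty)$ (in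 particular $U<+\infty$ $\mu_\infty$-a.e.). Set $\nu_\infty=e^{-U}\mu_\infty$. Let $\mathcal E(u,v)=-\int_X[BD_Hu,D_Hv]_H\,d\nu_\infty$ for $u,v\in W^{1,2}_H(X,\nu_\infty)$. Let $D(L_2)$ be the set of $u\in W^{1,2}_H(X,\nu_\infty)$ for which there is $g\in L^2(X,\nu_\infty)$ with $\mathcal E(u,v)=-\int_X g\,v\,d\nu_\infty$ for all $v\in\mathscr{FC}_b^1(X)$, and set $L_2u=g$. For $u\in\mathscr{FC}_b^{2,1}(X)$ let $D_H^2u(x)$ be the bilinear form $(h,k)\mapsto D^2u(x)(ih,ik)$ on $H$; if $u=\varphi(\langle\cdot,x_1^*\rangle,\dots,\langle\cdot,x_n^*\rangle)$, it is $\sum_{j,k}\partial_j\partial_k\varphi(\langle x,x_1^*\rangle,\dots,\langle x,x_n^*\rangle)\,i^*x_j^*\otimes i^*x_k^*$. Let $\mathrm{Tr}[D_H^2u(x)]_H=\sum_nD_H^2u(x)(h_n,h_n)$ for an orthonormal basis $(h_n)$ of $H$. Then $\mathscr{FC}_b^{2,1}(X)\subset D(L_2)$. Moreover, for every $u\in\mathscr{FC}_b^{2,1}(X)$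 the series defining $\mathrm{Tr}[D_H^2u(x)]_H$ converges to the same value for every $x\in X$ and every orthonormal basis of $H$, and $$L_2u(x)=\tfrac12\mathrm{Tr}[D_H^2u(x)]_H+\langle x,A^*Du(x)\rangle+[BD_Hu(x),D_HU(x)]_H\qquad\text{for }\nu_\infty\text{-a.e. }x\in X.$$ -/

import Mathlib

open Filter Topology MeasureTheory Set
open scoped ENNReal NNReal

noncomputable section

namespace PerturbedOU

universe u

/-! ### Nonnegative symmetric operators and their reproducing kernel Hilbert spaces -/

/-- A bounded linear operator `Q : X* → X` that is symmetric and nonnegative. -/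
structure NonnegSymmOp (X : Type u) [NormedAddCommGroup X] [NormedSpace ℝ X] where
  op : StrongDual ℝ X →L[ℝ] X
  symm : ∀ x' y' : StrongDual ℝ X, y' (op x') = x' (op y')
  nonneg : ∀ x' : StrongDual ℝ X, 0 ≤ x' (op x')

section RKHS

variable {X : Type u} [NormedAddCommGroup X] [NormedSpace ℝ X]

/-- A copy of `X*`, carrying the semi-inner product `[x', y'] = ⟨Q x', y'⟩`. Its separation quotient
is `Q X*` with the inner product `[Q x', Q y'] = ⟨Q x', y'⟩`. -/
def PreRKHS (_Q : NonnegSymmOp X) : Type u := StrongDual ℝ X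

instance (Q : NonnegSymmOp X) : AddCommGroup (PreRKHS Q) :=
  inferInstanceAs (AddCommGroup (StrongDual ℝ X))

instance (Q : NonnegSymmOp X) : Module ℝ (PreRKHS Q) :=
  inferInstanceAs (Module ℝ (StrongDual ℝ X))

/-- The identity from `X*` to its copy. -/
def toPre (Q : NonnegSymmOp X) : StrongDual ℝ X ≃ₗ[ℝ] PreRKHS Q := LinearEquiv.refl ℝ _

instance preCore (Q : NonnegSymmOp X) : PreInnerProductSpace.Core ℝ (PreRKHS Q) where
  inner x y := (toPre Q).symm y (Q.op ((toPre Q).symm x))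
  conj_inner_symm x y := by
    simpa using Q.symm ((toPre Q).symm y) ((toPre Q).symm x)
  re_inner_nonneg x := by
    simpa using Q.nonneg ((toPre Q).symm x)
  add_left x y z := by simp
  smul_left x y r := by simp

instance (Q : NonnegSymmOp X) : SeminormedAddCommGroup (PreRKHS Q) :=
  InnerProductSpace.Core.toSeminormedAddCommGroup (𝕜 := ℝ)

instance (Q : NonnegSymmOp X) : InnerProductSpace ℝ (PreRKHS Q) :=
  InnerProductSpace.ofCore (preCore Q)

/-- The reproducing kernel Hilbert space `H` of `Q`: the completion of `Q X*` for the inner product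
`[Q x', Q y']_H = ⟨Q x', y'⟩`. -/
abbrev RKHS (Q : NonnegSymmOp X) : Type u := UniformSpace.Completion (PreRKHS Q)

theorem pre_inner (Q : NonnegSymmOp X) (x' y' : StrongDual ℝ X) :
    inner ℝ (toPre Q x') (toPre Q y') = y' (Q.op x') := rfl

theorem pre_norm_sq (Q : NonnegSymmOp X) (x' : StrongDual ℝ X) :
    ‖toPre Q x'‖ ^ 2 = x' (Q.op x') := by
  rw [← real_inner_self_eq_norm_sq, pre_inner]

theorem pre_norm_le (Q : NonnegSymmOp X) (x' : StrongDual ℝ X) :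
    ‖toPre Q x'‖ ≤ √‖Q.op‖ * ‖x'‖ := by
  refine abs_le_of_sq_le_sq' ?_ (by positivity) |>.2
  have hs : √‖Q.op‖ ^ 2 = ‖Q.op‖ := Real.sq_sqrt (norm_nonneg Q.op)
  rw [pre_norm_sq, mul_pow, hs]
  calc x' (Q.op x') ≤ ‖x' (Q.op x')‖ := le_abs_self _
    _ ≤ ‖x'‖ * (‖Q.op‖ * ‖x'‖) :=
        (x'.le_opNorm _).trans (mul_le_mul_of_nonneg_left (Q.op.le_opNorm _) (norm_nonneg _))
    _ = ‖Q.op‖ * ‖x'‖ ^ 2 := by ring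

theorem norm_op_le (Q : NonnegSymmOp X) (x' : StrongDual ℝ X) :
    ‖Q.op x'‖ ≤ √‖Q.op‖ * ‖toPre Q x'‖ := by
  refine NormedSpace.norm_le_dual_bound ℝ _ (by positivity) fun y' => ?_
  rw [← pre_inner]
  calc ‖inner ℝ (toPre Q x') (toPre Q y')‖ ≤ ‖toPre Q x'‖ * ‖toPre Q y'‖ := norm_inner_le_norm _ _
    _ ≤ ‖toPre Q x'‖ * (√‖Q.op‖ * ‖y'‖) :=
        mul_le_mul_of_nonneg_left (pre_norm_le Q y') (norm_nonneg _)
    _ = √‖Q.op‖ * ‖toPre Q x'‖ * ‖y'‖ := by ring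

/-- The canonical map `i* : X* → H`, which sends `x'` to the element `Q x'` of `H`. -/
def istar (Q : NonnegSymmOp X) : StrongDual ℝ X →L[ℝ] RKHS Q :=
  (UniformSpace.Completion.toComplL (𝕜 := ℝ) (E := PreRKHS Q)).comp
    ((toPre Q).toLinearMap.mkContinuous (√‖Q.op‖) (pre_norm_le Q))

/-- The inclusion of `Q X*` (with the norm of `H`) in `X`. -/
def preEmb (Q : NonnegSymmOp X) : PreRKHS Q →L[ℝ] X :=
  (Q.op.toLinearMap.comp (toPre Q).symm.toLinearMap).mkContinuous (√‖Q.op‖)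
    (fun x => norm_op_le Q ((toPre Q).symm x))

variable [CompleteSpace X]

/-- The embedding `i : H → X`, the continuous extension of the inclusion of `Q X*` in `X`. -/
def emb (Q : NonnegSymmOp X) : RKHS Q →L[ℝ] X :=
  (preEmb Q).extend (UniformSpace.Completion.toComplL (𝕜 := ℝ) (E := PreRKHS Q))

end RKHS

section Main

variable {X : Type u} [NormedAddCommGroup X] [NormedSpace ℝ X]

/-! ### Semigroups, generators, adjoints -/

/-- `(T t)_{t ≥ 0}` is a strongly continuous semigroup of contractions on `X`
(values at negative times are irrelevant). -/
structure IsC0ContractionSemigroup (T : ℝ → X →L[ℝ] X) : Prop where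
  zero : T 0 = ContinuousLinearMap.id ℝ X
  add : ∀ s t : ℝ, 0 ≤ s → 0 ≤ t → T (s + t) = (T s).comp (T t)
  cont : ∀ x : X, ContinuousOn (fun t => T t x) (Ici 0)
  contraction : ∀ t : ℝ, 0 ≤ t → ‖T t‖ ≤ 1

/-- `A` is the infinitesimal generator of `(T t)_{t ≥ 0}`: `x ∈ D(A)` and `A x = y` if and only if
`(T t x - x) / t → y` as `t → 0+`. -/
def IsGenerator (A : X →ₗ.[ℝ] X) (T : ℝ → X →L[ℝ] X) : Prop :=
  ∀ x y : X, (∃ hx : x ∈ A.domain, A ⟨x, hx⟩ = y) ↔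
    Tendsto (fun t : ℝ => t⁻¹ • (T t x - x)) (𝓝[>] 0) (𝓝 y)

/-- `D(A*) ⊆ X*`: the functionals `x'` such that `x ↦ ⟨A x, x'⟩` extends from `D(A)` to a bounded
functional `y'` on `X`. -/
def adjDomain (A : X →ₗ.[ℝ] X) : Set (StrongDual ℝ X) :=
  {x' | ∃ y' : StrongDual ℝ X, ∀ x : A.domain, x' (A x) = y' x}

open Classical in
/-- The adjoint `A*` on `D(A*)` (and `0` outside `D(A*)`): the functional `y'` with
`⟨A x, x'⟩ = ⟨x, y'⟩` on `D(A)`, unique because `D(A)` is dense when `A` is a generator. -/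
def adj (A : X →ₗ.[ℝ] X) (x' : StrongDual ℝ X) : StrongDual ℝ X :=
  if h : x' ∈ adjDomain A then Classical.choose h else 0

/-! ### Covariance operators -/

/-- `Q_t x' = ∫₀ᵗ T s (Q ((T s)* x')) ds`. -/
def covInt (Q : NonnegSymmOp X) (T : ℝ → X →L[ℝ] X) (t : ℝ) (x' : StrongDual ℝ X) : X :=
  ∫ s in (0 : ℝ)..t, T s (Q.op (x'.comp (T s)))

/-- `γ` is a centred Gaussian measure on `X` with covariance operator `R`. -/
structure IsCentredGaussian [MeasurableSpace X] (γ : Measure X) (R : StrongDual ℝ X → X) :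
    Prop where
  gaussian : ProbabilityTheory.IsGaussian γ
  centred : ∀ x' : StrongDual ℝ X, ∫ x, x' x ∂γ = 0
  cov : ∀ x' y' : StrongDual ℝ X, y' (R x') = ∫ x, x' x * y' x ∂γ

/-! ### Cylindrical functions -/

/-- `φ ∈ C_b^k(ℝⁿ)`: `φ` and its derivatives up to order `k` are continuous and bounded. -/
def IsCb {n : ℕ} (k : ℕ) (φ : (Fin n → ℝ) → ℝ) : Prop :=
  ContDiff ℝ k φ ∧ ∀ j : ℕ, j ≤ k → ∃ C : ℝ, ∀ ξ, ‖iteratedFDeriv ℝ j φ ξ‖ ≤ C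

/-- The functions `x ↦ φ(⟨x, x'₁⟩, …, ⟨x, x'ₙ⟩)` with `φ ∈ C_b^k(ℝⁿ)` and `x'ᵢ ∈ S`. -/
def FCbOn (k : ℕ) (S : Set (StrongDual ℝ X)) : Set (X → ℝ) :=
  {f | ∃ (n : ℕ) (φ : (Fin n → ℝ) → ℝ) (x' : Fin n → StrongDual ℝ X),
    IsCb k φ ∧ (∀ i, x' i ∈ S) ∧ ∀ x, f x = φ fun i => x' i x}

/-- `FC_b^k(X)`. -/
def FCb (X : Type u) [NormedAddCommGroup X] [NormedSpace ℝ X] (k : ℕ) : Set (X → ℝ) :=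
  FCbOn k univ

/-- `FC_b^{k,1}(X)`: the functionals are taken in `D(A*)`. -/
def FCb1 (A : X →ₗ.[ℝ] X) (k : ℕ) : Set (X → ℝ) := FCbOn k (adjDomain A)

/-! ### Gradient along `H`, second derivative along `H`, trace -/

/-- `D_H f = i* D f` (for cylindrical `f`). -/
def gradCyl (Q : NonnegSymmOp X) (f : X → ℝ) (x : X) : RKHS Q := istar Q (fderiv ℝ f x)

/-- `D_H² f(x)`, the bilinear form `(h, k) ↦ D² f(x)(i h, i k)` on `H`. For
`f = φ(⟨·, x'₁⟩, …, ⟨·, x'ₙ⟩)` it is `∑ⱼₖ ∂ⱼ∂ₖφ(⟨x, x'₁⟩, …, ⟨x, x'ₙ⟩) i*x'ⱼ ⊗ i*x'ₖ`. -/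
def hessCyl [CompleteSpace X] (Q : NonnegSymmOp X) (f : X → ℝ) (x : X) :
    RKHS Q →L[ℝ] RKHS Q →L[ℝ] ℝ :=
  (fderiv ℝ (fderiv ℝ f) x).bilinearComp (emb Q) (emb Q)

/-- The trace `∑ₙ Φ(hₙ, hₙ)` of a bilinear form on a Hilbert space, `(hₙ)` an orthonormal basis. -/
def formTrace {H : Type u} [NormedAddCommGroup H] [InnerProductSpace ℝ H] [CompleteSpace H]
    (Φ : H →L[ℝ] H →L[ℝ] ℝ) : ℝ :=
  ∑' h : (exists_hilbertBasis ℝ H).choose, Φ (h : H) (h : H)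

/-! ### Sobolev spaces -/

variable [MeasurableSpace X]

/-- `(f, G)` lies in the closure of the graph of `D_H : FC_b^1(X) → L^p(X, γ; H)` in
`L^p(X, γ) × L^p(X, γ; H)`. -/
def HasSobolevGrad (Q : NonnegSymmOp X) (γ : Measure X) (p : ℝ≥0∞) (f : X → ℝ)
    (G : X → RKHS Q) : Prop :=
  MemLp f p γ ∧ MemLp G p γ ∧ ∃ F : ℕ → X → ℝ, (∀ n, F n ∈ FCb X 1) ∧
    Tendsto (fun n => eLpNorm (F n - f) p γ) atTop (𝓝 0) ∧
    Tendsto (fun n => eLpNorm (gradCyl Q (F n) - G) p γ) atTop (𝓝 0)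

/-- `f ∈ W_H^{1,p}(X, γ)`, the domain of the closure of `D_H` in `L^p(X, γ)`. -/
def MemSobolev (Q : NonnegSymmOp X) (γ : Measure X) (p : ℝ≥0∞) (f : X → ℝ) : Prop :=
  ∃ G : X → RKHS Q, HasSobolevGrad Q γ p f G

open Classical in
/-- `D_H f` for `f ∈ W_H^{1,p}(X, γ)`, where `D_H` is the closed operator (defined up to
`γ`-null sets when `D_H` is closable), and `0` for other `f`. -/
def sobolevGrad (Q : NonnegSymmOp X) (γ : Measure X) (p : ℝ≥0∞) (f : X → ℝ) : X → RKHS Q :=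
  if h : MemSobolev Q γ p f then Classical.choose h else 0

/-! ### The weight -/

/-- `U : X → (-∞, +∞]` is proper, lower semicontinuous, convex (it has a convex epigraph). -/
structure IsProperLscConvex (U : X → EReal) : Prop where
  ne_bot : ∀ x, U x ≠ ⊥
  proper : ∃ x, U x ≠ ⊤
  lsc : LowerSemicontinuous U
  convex : Convex ℝ {z : X × ℝ | U z.1 ≤ (z.2 : EReal)}

/-- `ν = e^{-U} μ`, with `e^{-∞} = 0`. -/
def weighted (μ : Measure X) (U : X → EReal) : Measure X :=
  μ.withDensity fun x => EReal.exp (-(U x))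

/-! ### The operator `B`, the form and the operator `L₂` -/

variable [CompleteSpace X]

open Classical in
/-- The bounded operator `B` on `H` with `B i*x' = Q_∞ A*x'` for all `x' ∈ D(A*)` (as elements of
`X`, through the embedding `i : H → X`), if there is one. -/
def opB (Q : NonnegSymmOp X) (A : X →ₗ.[ℝ] X) (Qinf : StrongDual ℝ X →L[ℝ] X) :
    RKHS Q →L[ℝ] RKHS Q :=
  if h : ∃ B : RKHS Q →L[ℝ] RKHS Q, ∀ x' ∈ adjDomain A, emb Q (B (istar Q x')) = Qinf (adj A x')
  then Classical.choose h else 0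

/-- The form `𝓔(u, v) = -∫ [B D_H u, D_H v]_H dν` on `W_H^{1,2}(X, ν)`. -/
def form (Q : NonnegSymmOp X) (B : RKHS Q →L[ℝ] RKHS Q) (ν : Measure X) (u v : X → ℝ) : ℝ :=
  -∫ x, inner ℝ (B (sobolevGrad Q ν 2 u x)) (sobolevGrad Q ν 2 v x) ∂ν

/-- `u ∈ W_H^{1,2}(X, ν)`, `g ∈ L²(X, ν)` and `𝓔(u, v) = -∫ g v dν` for all `v ∈ FC_b^1(X)`. -/
def IsL2Value (Q : NonnegSymmOp X) (B : RKHS Q →L[ℝ] RKHS Q) (ν : Measure X) (u g : X → ℝ) :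
    Prop :=
  MemSobolev Q ν 2 u ∧ MemLp g 2 ν ∧ ∀ v ∈ FCb X 1, form Q B ν u v = -∫ x, g x * v x ∂ν

/-- `D(L₂)`. -/
def domL2 (Q : NonnegSymmOp X) (B : RKHS Q →L[ℝ] RKHS Q) (ν : Measure X) : Set (X → ℝ) :=
  {u | ∃ g : X → ℝ, IsL2Value Q B ν u g}

open Classical in
/-- `L₂ u` for `u ∈ D(L₂)` (defined up to `ν`-null sets), and `0` for other `u`. -/
def opL2 (Q : NonnegSymmOp X) (B : RKHS Q →L[ℝ] RKHS Q) (ν : Measure X) (u : X → ℝ) : X → ℝ :=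
  if h : u ∈ domL2 Q B ν then Classical.choose h else 0

end Main

end PerturbedOU

end

/-!
The operator `B` on `H` is characterised by `i B i* x' = Q_∞ A* x'`, so that for `x' ∈ D(A*)` the
Gaussian integration by parts formula for `μ_∞` in the direction `Q_∞ A* x'` reads
`∫ [B i* x', D_H w]_H dμ_∞ = ∫ ⟨x, A* x'⟩ w dμ_∞` (`hasDivergence_gaussian`). Everything
follows from this identity: it says that the constant field `B i* x'` has the divergence
`⟨·, A* x'⟩`.

*The Lyapunov equation.* Differentiating `s ↦ ⟨Q e^{sA*} x', e^{sA*} y'⟩` for `x', y' ∈ D(A*)` and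
letting the time tend to infinity gives `⟨Q_∞ x', A* y'⟩ + ⟨Q_∞ y', A* x'⟩ = -⟨Q x', y'⟩`
(`lyapunov`). Since `D(A*)` separates the points of `X`, `i* D(A*)` is dense in `H`, hence
`B + B* = -I` (`inner_opB_self`). In particular `B` has dense range, and the directions `B i* x'`
along which integration by parts is available are dense in `H` (`denseRange_opB_istar`).

*The weight.* The formula passes to `ν_∞ = e^{-U} μ_∞`, with the divergence
`⟨·, A* x'⟩ + [B i* x', D_H U]_H` (`HasDivergence.expDensity`). The function `e^{-U}` has a second
moment because `U` has an affine minorant, but it is not a bounded function of `U`; it is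
approximated by the bounded functions `(e^U + ε)⁻¹`, for which `U` may be replaced by cylindrical
functions, and `ε → 0` is a dominated limit.

*Closability.* A measure with square integrable divergences along a dense set of directions has a
closable gradient in `L²` (`HasSobolevGrad.ae_unique`), because cylindrical functions separate
integrable functions. Thus the gradient of the closed operator is the classical one on cylindrical
functions, and `D_H U` does not depend on the exponent, so that it lies in every `L^p(μ_∞; H)`.

*The formula.* For `u = φ(⟨·, x'₁⟩, …, ⟨·, x'ₙ⟩)`, `B D_H u = ∑ⱼ ∂ⱼφ B i* x'ⱼ` has the divergence
`∑ⱼ (∂ⱼφ (⟨·, A* x'ⱼ⟩ + [B i* x'ⱼ, D_H U]_H) - [B i* x'ⱼ, D_H ∂ⱼφ]_H)` for `ν_∞`. The first two sums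
are the last two terms of `L₂ u`, and the third is half of the trace of `D_H² u`, because the second
derivative of `φ` is symmetric and the symmetric part of `B` is `-I / 2` (`sum_inner_opB_gradCyl`).
-/

namespace PerturbedOU

universe u

/-! ### Contraction semigroups and the adjoint of the generator -/

section Semigroup

variable {X : Type u} [NormedAddCommGroup X] [NormedSpace ℝ X]

theorem hasDerivWithinAt_Ioi_of_tendsto {E : Type*} [NormedAddCommGroup E] [NormedSpace ℝ E]
    {f : ℝ → E} {f' : E} {s : ℝ}
    (h : Tendsto (fun r : ℝ => r⁻¹ • (f (s + r) - f s)) (𝓝[>] 0) (𝓝 f')) :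
    HasDerivWithinAt f f' (Ioi s) s := by
  rw [hasDerivWithinAt_iff_tendsto_slope' (by simp)]
  have hsub : Tendsto (fun r : ℝ => r - s) (𝓝[>] s) (𝓝[>] 0) := by
    refine tendsto_nhdsWithin_iff.2 ⟨?_, ?_⟩
    · have : Tendsto (fun r : ℝ => r - s) (𝓝 s) (𝓝 (s - s)) := by
        exact (continuous_id.sub continuous_const).tendsto s
      rw [sub_self] at this
      exact this.mono_left nhdsWithin_le_nhds
    · filter_upwards [self_mem_nhdsWithin] with r hr
      exact sub_pos.2 (mem_Ioi.1 hr)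
  refine (h.comp hsub).congr fun r => ?_
  simp [slope_def_module]

/-- The orbit `s ↦ T s x`, extended to negative times by its value at `0`, so that it is continuous
on the whole line. -/
def orbit (T : ℝ → X →L[ℝ] X) (x : X) (s : ℝ) : X := T (max s 0) x

theorem orbit_of_nonneg (T : ℝ → X →L[ℝ] X) (x : X) {s : ℝ} (hs : 0 ≤ s) :
    orbit T x s = T s x := by
  rw [orbit, max_eq_left hs]

variable {T : ℝ → X →L[ℝ] X} {A : X →ₗ.[ℝ] X}

theorem IsC0ContractionSemigroup.continuous_orbit (hT : IsC0ContractionSemigroup T) (x : X) :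
    Continuous (orbit T x) :=
  (hT.cont x).comp_continuous (by fun_prop) fun s => mem_Ici.2 (le_max_right s 0)

theorem IsC0ContractionSemigroup.norm_le (hT : IsC0ContractionSemigroup T) {t : ℝ} (ht : 0 ≤ t)
    (x : X) : ‖T t x‖ ≤ ‖x‖ := by
  simpa using (T t).le_of_opNorm_le (hT.contraction t ht) x

theorem IsC0ContractionSemigroup.norm_orbit_le (hT : IsC0ContractionSemigroup T) (x : X) (s : ℝ) :
    ‖orbit T x s‖ ≤ ‖x‖ :=
  hT.norm_le (le_max_right _ _) x

theorem IsC0ContractionSemigroup.add_apply (hT : IsC0ContractionSemigroup T) {s t : ℝ} (hs : 0 ≤ s)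
    (ht : 0 ≤ t) (x : X) : T (s + t) x = T s (T t x) := by
  rw [hT.add s t hs ht]; rfl

theorem IsGenerator.tendsto (hA : IsGenerator A T) (x : A.domain) :
    Tendsto (fun t : ℝ => t⁻¹ • (T t (x : X) - x)) (𝓝[>] 0) (𝓝 (A x)) :=
  (hA x (A x)).1 ⟨x.2, rfl⟩

theorem IsGenerator.hasDerivWithinAt_orbit (hA : IsGenerator A T) (hT : IsC0ContractionSemigroup T)
    (x : A.domain) {s : ℝ} (hs : 0 ≤ s) :
    HasDerivWithinAt (orbit T (x : X)) (orbit T (A x) s) (Ioi s) s := by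
  refine hasDerivWithinAt_Ioi_of_tendsto ?_
  rw [orbit_of_nonneg _ (A x) hs]
  refine (((T s).continuous.tendsto _).comp (hA.tendsto x)).congr' ?_
  filter_upwards [self_mem_nhdsWithin] with t ht
  have ht' : 0 ≤ t := le_of_lt ht
  simp only [Function.comp_apply, map_smul, map_sub]
  rw [orbit_of_nonneg _ _ hs, orbit_of_nonneg _ _ (by positivity), ← hT.add_apply hs ht']

theorem adj_spec {x' : StrongDual ℝ X} (hx' : x' ∈ adjDomain A) (x : A.domain) :
    x' (A x) = adj A x' x := by
  rw [adj, dif_pos hx']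
  exact Classical.choose_spec hx' x

theorem adj_eq_of_dense (hd : Dense (A.domain : Set X)) {x' y' : StrongDual ℝ X}
    (h : ∀ x : A.domain, x' (A x) = y' x) : adj A x' = y' := by
  have hx' : x' ∈ adjDomain A := ⟨y', h⟩
  refine DFunLike.coe_injective (Continuous.ext_on hd (adj A x').continuous y'.continuous ?_)
  intro x hx
  rw [← adj_spec hx' ⟨x, hx⟩, h]

/-- `D(A*)` as a subspace of `X*`. -/
def adjSubmodule (A : X →ₗ.[ℝ] X) : Submodule ℝ (StrongDual ℝ X) where
  carrier := adjDomain A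
  zero_mem' := ⟨0, by simp⟩
  add_mem' := by
    rintro a b ⟨a', ha⟩ ⟨b', hb⟩
    exact ⟨a' + b', fun x => by simp [ha, hb]⟩
  smul_mem' := by
    rintro c a ⟨a', ha⟩
    exact ⟨c • a', fun x => by simp [ha]⟩

theorem adj_add (hd : Dense (A.domain : Set X)) {x' y' : StrongDual ℝ X} (hx' : x' ∈ adjDomain A)
    (hy' : y' ∈ adjDomain A) : adj A (x' + y') = adj A x' + adj A y' :=
  adj_eq_of_dense hd fun x => by simp [adj_spec hx', adj_spec hy']

theorem adj_smul (hd : Dense (A.domain : Set X)) (c : ℝ) {x' : StrongDual ℝ X}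
    (hx' : x' ∈ adjDomain A) : adj A (c • x') = c • adj A x' :=
  adj_eq_of_dense hd fun x => by simp [adj_spec hx']

theorem adj_sum_smul (hd : Dense (A.domain : Set X)) {n : ℕ} (c : Fin n → ℝ)
    {x' : Fin n → StrongDual ℝ X} (hx' : ∀ i, x' i ∈ adjDomain A) :
    adj A (∑ i, c i • x' i) = ∑ i, c i • adj A (x' i) :=
  adj_eq_of_dense hd fun x => by
    simp [fun i => adj_spec (hx' i) x]

/-- The orbit `s ↦ (T s)* x'` of the adjoint semigroup, constant for negative times. -/
def dualOrbit (T : ℝ → X →L[ℝ] X) (x' : StrongDual ℝ X) (s : ℝ) : StrongDual ℝ X :=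
  x'.comp (T (max s 0))

theorem dualOrbit_of_nonneg (x' : StrongDual ℝ X) {s : ℝ} (hs : 0 ≤ s) :
    dualOrbit T x' s = x'.comp (T s) := by
  rw [dualOrbit, max_eq_left hs]

/-- A contraction semigroup is jointly continuous. -/
theorem IsC0ContractionSemigroup.continuous_orbit_comp (hT : IsC0ContractionSemigroup T)
    {v : ℝ → X} (hv : Continuous v) : Continuous fun s => orbit T (v s) s := by
  refine continuous_iff_continuousAt.2 fun s₀ => ?_
  have h1 : Tendsto (fun s => orbit T (v s₀) s) (𝓝 s₀) (𝓝 (orbit T (v s₀) s₀)) :=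
    (hT.continuous_orbit (v s₀)).tendsto s₀
  have h2 : Tendsto (fun s => orbit T (v s - v s₀) s) (𝓝 s₀) (𝓝 0) := by
    refine squeeze_zero_norm (fun s => hT.norm_orbit_le _ s) ?_
    have h3 : Tendsto (fun s => ‖v s - v s₀‖) (𝓝 s₀) (𝓝 ‖v s₀ - v s₀‖) :=
      ((hv.sub continuous_const).norm).tendsto s₀
    simpa using h3
  have h4 := h2.add h1
  rw [zero_add] at h4
  refine h4.congr fun s => ?_
  simp [orbit]

variable [CompleteSpace X]

theorem IsGenerator.integral_orbit (hA : IsGenerator A T) (hT : IsC0ContractionSemigroup T)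
    (x : A.domain) {t : ℝ} (ht : 0 ≤ t) :
    ∫ s in (0 : ℝ)..t, orbit T (A x) s = T t x - x := by
  rw [intervalIntegral.integral_eq_sub_of_hasDeriv_right_of_le ht
    (hT.continuous_orbit (x : X)).continuousOn
    (fun s hs => hA.hasDerivWithinAt_orbit hT x hs.1.le)
    ((hT.continuous_orbit _).intervalIntegrable _ _), orbit_of_nonneg _ _ ht,
    orbit_of_nonneg _ _ le_rfl, hT.zero]
  rfl

theorem IsC0ContractionSemigroup.hasDerivAt_integral_orbit (hT : IsC0ContractionSemigroup T)
    (x : X) (t : ℝ) :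
    HasDerivAt (fun u : ℝ => ∫ s in (0 : ℝ)..u, orbit T x s) (orbit T x t) t :=
  ((hT.continuous_orbit x).integral_hasStrictDerivAt 0 t).hasDerivAt

theorem IsGenerator.map_integral_orbit (hA : IsGenerator A T) (hT : IsC0ContractionSemigroup T)
    (x : X) {t : ℝ} (ht : 0 ≤ t) :
    ∃ h : ∫ s in (0 : ℝ)..t, orbit T x s ∈ A.domain,
      A ⟨∫ s in (0 : ℝ)..t, orbit T x s, h⟩ = T t x - x := by
  -- both sides are limits of difference quotients of `u ↦ ∫₀ᵘ T s x ds`, at `t` and at `0`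
  have h0 : T t x - x = orbit T x t - orbit T x 0 := by
    rw [orbit_of_nonneg _ _ ht, orbit_of_nonneg _ _ le_rfl, hT.zero]; rfl
  rw [h0]
  refine (hA _ _).2 ?_
  have h1 := (hT.hasDerivAt_integral_orbit x t).tendsto_slope_zero_right
  have h2 := (hT.hasDerivAt_integral_orbit x 0).tendsto_slope_zero_right
  refine (h1.sub h2).congr' ?_
  filter_upwards [self_mem_nhdsWithin] with r hr
  have hr' : 0 ≤ r := le_of_lt hr
  rw [← smul_sub]
  congr 1
  have hI := fun a b => (hT.continuous_orbit x).intervalIntegrable a b (μ := volume)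
  have h3 : T r (∫ s in (0 : ℝ)..t, orbit T x s) = ∫ s in r..(r + t), orbit T x s := by
    rw [← (T r).intervalIntegral_comp_comm (hI _ _)]
    have h4 := intervalIntegral.integral_comp_add_left (a := 0) (b := t) (orbit T x) r
    rw [add_zero] at h4
    rw [← h4]
    refine intervalIntegral.integral_congr fun s hs => ?_
    rw [uIcc_of_le ht] at hs
    rw [orbit_of_nonneg _ _ hs.1, orbit_of_nonneg _ _ (add_nonneg hr' hs.1),
      hT.add_apply hr' hs.1]
  rw [h3, ← intervalIntegral.integral_add_adjacent_intervals (hI r 0) (hI 0 (r + t)),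
    intervalIntegral.integral_symm 0 r, intervalIntegral.integral_same, zero_add, add_comm r t]
  abel

theorem IsGenerator.dense_domain (hA : IsGenerator A T) (hT : IsC0ContractionSemigroup T) :
    Dense (A.domain : Set X) := by
  intro x
  have h := (hT.hasDerivAt_integral_orbit x 0).tendsto_slope_zero_right
  have h0 : orbit T x 0 = x := by rw [orbit_of_nonneg _ _ le_rfl, hT.zero]; rfl
  rw [h0] at h
  refine mem_closure_of_tendsto h ?_
  filter_upwards [self_mem_nhdsWithin] with r hr
  have hr' : 0 ≤ r := le_of_lt hr
  rw [intervalIntegral.integral_same, zero_add, sub_zero]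
  exact A.domain.smul_mem _ (hA.map_integral_orbit hT x hr').1


/-- `D(A*)` separates the points of `X`: it contains the functionals
`x ↦ ∫₀ᵗ ⟨T s x, x'⟩ ds`, whose averages tend weakly* to `x'` as `t → 0+`. -/
theorem eq_zero_of_forall_adjDomain (hA : IsGenerator A T) (hT : IsC0ContractionSemigroup T)
    {x : X} (h : ∀ x' ∈ adjDomain A, x' x = 0) : x = 0 := by
  refine SeparatingDual.eq_zero_of_forall_dual_eq_zero (R := ℝ) fun x' => ?_
  have hI := fun z a b => (hT.continuous_orbit z).intervalIntegrable a b (μ := volume)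
  have key : ∀ t : ℝ, 0 ≤ t → x' (∫ s in (0 : ℝ)..t, orbit T x s) = 0 := by
    intro t ht
    let J : X →ₗ[ℝ] X :=
      { toFun := fun z => ∫ s in (0 : ℝ)..t, orbit T z s
        map_add' := fun y z => by
          rw [← intervalIntegral.integral_add (hI y 0 t) (hI z 0 t)]
          simp [orbit]
        map_smul' := fun c z => by
          rw [RingHom.id_apply, ← intervalIntegral.integral_smul]
          simp [orbit] }
    have hJ : ∀ z, ‖J z‖ ≤ |t - 0| * ‖z‖ := fun z => by
      rw [mul_comm]
      exact intervalIntegral.norm_integral_le_of_norm_le_const fun s _ => hT.norm_orbit_le z s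
    refine h (x'.comp (J.mkContinuous _ hJ)) ⟨x'.comp (T t) - x', fun z => ?_⟩
    change x' (∫ s in (0 : ℝ)..t, orbit T (A z) s) = _
    rw [hA.integral_orbit hT z ht]
    simp
  have h1 := (hT.hasDerivAt_integral_orbit x 0).tendsto_slope_zero_right
  have h2 := (x'.continuous.tendsto _).comp h1
  have h0 : orbit T x 0 = x := by rw [orbit_of_nonneg _ _ le_rfl, hT.zero]; rfl
  rw [h0] at h2
  refine tendsto_nhds_unique h2 (tendsto_const_nhds.congr' ?_)
  filter_upwards [self_mem_nhdsWithin] with r hr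
  have hr' : 0 ≤ r := le_of_lt hr
  simp [key r hr']

theorem adj_integral_orbit (hA : IsGenerator A T) (hT : IsC0ContractionSemigroup T)
    {x' : StrongDual ℝ X} (hx' : x' ∈ adjDomain A) (x : X) {t : ℝ} (ht : 0 ≤ t) :
    adj A x' (∫ s in (0 : ℝ)..t, orbit T x s) = x' (T t x) - x' x := by
  obtain ⟨h, h'⟩ := hA.map_integral_orbit hT x ht
  rw [← map_sub, ← h', adj_spec hx']

theorem dualOrbit_add_sub (hA : IsGenerator A T) (hT : IsC0ContractionSemigroup T)
    {x' : StrongDual ℝ X} (hx' : x' ∈ adjDomain A) (x : X) {s r : ℝ} (hs : 0 ≤ s) (hr : 0 ≤ r) :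
    dualOrbit T x' (s + r) x - dualOrbit T x' s x =
      adj A x' (∫ q in (0 : ℝ)..r, orbit T (T s x) q) := by
  rw [adj_integral_orbit hA hT hx' _ hr, dualOrbit_of_nonneg _ hs,
    dualOrbit_of_nonneg _ (add_nonneg hs hr), ContinuousLinearMap.comp_apply,
    ContinuousLinearMap.comp_apply, add_comm s r, hT.add_apply hr hs]

theorem norm_dualOrbit_add_sub_le (hA : IsGenerator A T) (hT : IsC0ContractionSemigroup T)
    {x' : StrongDual ℝ X} (hx' : x' ∈ adjDomain A) {s r : ℝ} (hs : 0 ≤ s) (hr : 0 ≤ r) :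
    ‖dualOrbit T x' (s + r) - dualOrbit T x' s‖ ≤ ‖adj A x'‖ * r := by
  refine ContinuousLinearMap.opNorm_le_bound _ (by positivity) fun x => ?_
  rw [_root_.sub_apply, dualOrbit_add_sub hA hT hx' x hs hr, mul_assoc]
  refine (adj A x').le_opNorm_of_le ?_
  have h : ∀ q ∈ uIoc 0 r, ‖orbit T (T s x) q‖ ≤ ‖x‖ := fun q _ =>
    (hT.norm_orbit_le _ q).trans (hT.norm_le hs x)
  refine (intervalIntegral.norm_integral_le_of_norm_le_const h).trans_eq ?_
  rw [sub_zero, abs_of_nonneg hr, mul_comm]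

/-- On `D(A*)` the adjoint semigroup is strongly continuous. -/
theorem continuous_dualOrbit (hA : IsGenerator A T) (hT : IsC0ContractionSemigroup T)
    {x' : StrongDual ℝ X} (hx' : x' ∈ adjDomain A) : Continuous (dualOrbit T x') := by
  have key : ∀ s t : ℝ, s ≤ t →
      ‖dualOrbit T x' t - dualOrbit T x' s‖ ≤ ‖adj A x'‖ * (t - s) := by
    intro s t hst
    have h := norm_dualOrbit_add_sub_le hA hT hx' (le_max_right s 0)
      (sub_nonneg.2 (max_le_max_right 0 hst))
    rw [add_sub_cancel] at h
    have e : ∀ q : ℝ, dualOrbit T x' (max q 0) = dualOrbit T x' q := fun q => by simp [dualOrbit]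
    rw [e, e] at h
    refine h.trans (mul_le_mul_of_nonneg_left ?_ (norm_nonneg _))
    rcases le_total s 0 with h1 | h1 <;> rcases le_total t 0 with h2 | h2 <;>
      simp [h1, h2] <;> linarith
  refine (LipschitzWith.of_dist_le_mul (K := ‖adj A x'‖₊) fun s t => ?_).continuous
  rw [dist_eq_norm, Real.dist_eq, coe_nnnorm]
  rcases le_total s t with h | h
  · rw [norm_sub_rev, abs_sub_comm, abs_of_nonneg (sub_nonneg.2 h)]
    exact key s t h
  · rw [abs_of_nonneg (sub_nonneg.2 h)]
    exact key t s h

/-- On `D(A*)` the adjoint semigroup is weakly* differentiable, with derivative `(T s)* A* x'`; its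
increments being Lipschitz, the functionals may be evaluated at a convergent family of points. -/
theorem tendsto_dualOrbit_slope (hA : IsGenerator A T) (hT : IsC0ContractionSemigroup T)
    {x' : StrongDual ℝ X} (hx' : x' ∈ adjDomain A) {s : ℝ} (hs : 0 ≤ s) {z : ℝ → X} {z₀ : X}
    (hz : Tendsto z (𝓝[>] 0) (𝓝 z₀)) :
    Tendsto (fun r : ℝ => r⁻¹ * (dualOrbit T x' (s + r) - dualOrbit T x' s) (z r)) (𝓝[>] 0)
      (𝓝 (adj A x' (orbit T z₀ s))) := by
  have h1 := (hT.hasDerivAt_integral_orbit (T s z₀) 0).tendsto_slope_zero_right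
  have h2 := ((adj A x').continuous.tendsto _).comp h1
  rw [orbit_of_nonneg _ _ le_rfl, hT.zero, ContinuousLinearMap.id_apply] at h2
  rw [orbit_of_nonneg _ _ hs]
  have h3 : Tendsto (fun r : ℝ => r⁻¹ * (dualOrbit T x' (s + r) - dualOrbit T x' s) (z r - z₀))
      (𝓝[>] 0) (𝓝 0) := by
    have h4 : Tendsto (fun r => ‖adj A x'‖ * ‖z r - z₀‖) (𝓝[>] 0) (𝓝 0) := by
      have := ((hz.sub_const z₀).norm).const_mul ‖adj A x'‖
      simpa using this
    refine squeeze_zero_norm' ?_ h4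
    filter_upwards [self_mem_nhdsWithin] with r hr
    have hr0 : 0 < r := hr
    rw [norm_mul, norm_inv, Real.norm_of_nonneg hr0.le, inv_mul_le_iff₀ hr0]
    refine (ContinuousLinearMap.le_opNorm _ _).trans ?_
    calc _ ≤ (‖adj A x'‖ * r) * ‖z r - z₀‖ :=
          mul_le_mul_of_nonneg_right (norm_dualOrbit_add_sub_le hA hT hx' hs hr0.le)
            (norm_nonneg _)
      _ = _ := by ring
  have h5 := h3.add h2
  rw [zero_add] at h5
  refine h5.congr' ?_
  filter_upwards [self_mem_nhdsWithin] with r hr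
  have hr0 : 0 < r := hr
  rw [Function.comp_apply, zero_add, intervalIntegral.integral_same, sub_zero, map_smul,
    ← dualOrbit_add_sub hA hT hx' z₀ hs hr0.le, smul_eq_mul, map_sub]
  simp only [_root_.sub_apply]
  ring

/-- If `f` tends to `l` at infinity and its primitive converges, then `l = 0`. -/
theorem eq_zero_of_tendsto_of_tendsto_integral {f : ℝ → ℝ} (hf : Continuous f) {l m : ℝ}
    (hl : Tendsto f atTop (𝓝 l)) (hm : Tendsto (fun t => ∫ s in (0 : ℝ)..t, f s) atTop (𝓝 m)) :
    l = 0 := by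
  have hI := fun a b => hf.intervalIntegrable a b (μ := volume)
  have h1 : Tendsto (fun t => ∫ s in t..(t + 1), f s) atTop (𝓝 0) := by
    have h2 := (hm.comp (tendsto_atTop_add_const_right atTop (1 : ℝ) tendsto_id)).sub hm
    rw [sub_self] at h2
    refine h2.congr fun t => ?_
    simp only [Function.comp_apply, id]
    exact intervalIntegral.integral_interval_sub_left (hI _ _) (hI _ _)
  have h2 : Tendsto (fun t => ∫ s in t..(t + 1), f s) atTop (𝓝 l) := by
    refine Metric.tendsto_atTop.2 fun ε hε => ?_
    obtain ⟨N, hN⟩ := Metric.tendsto_atTop.1 hl (ε / 2) (half_pos hε)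
    refine ⟨N, fun t ht => ?_⟩
    have h3 : ∫ s in t..(t + 1), (f s - l) = (∫ s in t..(t + 1), f s) - l := by
      rw [intervalIntegral.integral_sub (hI _ _) (by simp)]
      simp
    rw [Real.dist_eq, ← h3, ← Real.norm_eq_abs]
    refine (intervalIntegral.norm_integral_le_of_norm_le_const (C := ε / 2) fun s hs => ?_).trans_lt
      (by simpa using half_lt_self hε)
    rw [uIoc_of_le (by linarith)] at hs
    simpa [Real.dist_eq] using (hN s (ht.trans hs.1.le)).le
  exact tendsto_nhds_unique h2 h1

/-- The Lyapunov equation `⟨Q_∞ x', A* y'⟩ + ⟨Q_∞ y', A* x'⟩ = -⟨Q x', y'⟩`: the function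
`s ↦ ⟨Q (T s)* x', (T s)* y'⟩` has the integral `⟨Q_∞ x', y'⟩` over the half line and tends to
`⟨Q x', y'⟩ + ⟨Q_∞ x', A* y'⟩ + ⟨Q_∞ y', A* x'⟩` at infinity. -/
theorem lyapunov (Q : NonnegSymmOp X) (hT : IsC0ContractionSemigroup T) (hA : IsGenerator A T)
    {Qinf : StrongDual ℝ X →L[ℝ] X}
    (hQinf : ∀ x' y' : StrongDual ℝ X,
      Tendsto (fun t : ℝ => y' (covInt Q T t x')) atTop (𝓝 (y' (Qinf x'))))
    {x' y' : StrongDual ℝ X} (hx' : x' ∈ adjDomain A) (hy' : y' ∈ adjDomain A) :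
    adj A x' (Qinf y') + adj A y' (Qinf x') = -y' (Q.op x') := by
  have hcx := continuous_dualOrbit hA hT hx'
  have hcy := continuous_dualOrbit hA hT hy'
  have hgx := hT.continuous_orbit_comp (Q.op.continuous.comp hcx)
  have hgy := hT.continuous_orbit_comp (Q.op.continuous.comp hcy)
  simp only [Function.comp_def] at hgx hgy
  let f : ℝ → ℝ := fun s => dualOrbit T y' s (Q.op (dualOrbit T x' s))
  have hf : Continuous f := hcy.clm_apply (Q.op.continuous.comp hcx)
  have hcov : ∀ z' : StrongDual ℝ X, ∀ t : ℝ, 0 ≤ t →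
      covInt Q T t z' = ∫ s in (0 : ℝ)..t, orbit T (Q.op (dualOrbit T z' s)) s := by
    intro z' t ht
    refine intervalIntegral.integral_congr fun s hs => ?_
    rw [uIcc_of_le ht] at hs
    simp only [dualOrbit_of_nonneg z' hs.1, orbit_of_nonneg _ _ hs.1]
  have hderiv : ∀ s : ℝ, 0 ≤ s → HasDerivWithinAt f
      (adj A x' (orbit T (Q.op (dualOrbit T y' s)) s) +
        adj A y' (orbit T (Q.op (dualOrbit T x' s)) s)) (Ioi s) s := by
    intro s hs
    -- split the increment of `f` into increments of one functional at a time; by the symmetry of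
    -- `Q` each of them is evaluated at a norm convergent family of points
    refine hasDerivWithinAt_Ioi_of_tendsto ?_
    have h1 : Tendsto (fun r : ℝ => Q.op (dualOrbit T y' (s + r))) (𝓝[>] 0)
        (𝓝 (Q.op (dualOrbit T y' s))) := by
      have : Continuous fun r : ℝ => Q.op (dualOrbit T y' (s + r)) := by fun_prop
      have := this.tendsto 0
      rw [add_zero] at this
      exact this.mono_left nhdsWithin_le_nhds
    have h2 := (tendsto_dualOrbit_slope hA hT hx' hs h1).add
      (tendsto_dualOrbit_slope hA hT hy' hs
        (tendsto_const_nhds (x := Q.op (dualOrbit T x' s))))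
    refine h2.congr fun r => ?_
    simp only [f, smul_eq_mul, _root_.sub_apply]
    rw [Q.symm (dualOrbit T x' (s + r)) (dualOrbit T y' (s + r)) |>.symm,
      Q.symm (dualOrbit T x' s) (dualOrbit T y' (s + r)) |>.symm]
    ring
  have hFTC : ∀ t : ℝ, 0 ≤ t → f t = f 0 +
      (adj A x' (covInt Q T t y') + adj A y' (covInt Q T t x')) := by
    intro t ht
    have h1 := intervalIntegral.integral_eq_sub_of_hasDeriv_right_of_le ht hf.continuousOn
      (fun s hs => hderiv s hs.1.le)
      ((((adj A x').continuous.comp hgy).add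
        ((adj A y').continuous.comp hgx)).intervalIntegrable _ _)
    have hIx : IntervalIntegrable (fun s => adj A x' (orbit T (Q.op (dualOrbit T y' s)) s))
        volume 0 t := ((adj A x').continuous.comp hgy).intervalIntegrable _ _
    have hIy : IntervalIntegrable (fun s => adj A y' (orbit T (Q.op (dualOrbit T x' s)) s))
        volume 0 t := ((adj A y').continuous.comp hgx).intervalIntegrable _ _
    rw [intervalIntegral.integral_add hIx hIy,
      (adj A x').intervalIntegral_comp_comm (hgy.intervalIntegrable _ _),
      (adj A y').intervalIntegral_comp_comm (hgx.intervalIntegrable _ _),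
      ← hcov y' t ht, ← hcov x' t ht] at h1
    linarith
  have hlim : Tendsto f atTop
      (𝓝 (f 0 + (adj A x' (Qinf y') + adj A y' (Qinf x')))) := by
    refine (((hQinf y' (adj A x')).add (hQinf x' (adj A y'))).const_add (f 0)).congr' ?_
    filter_upwards [eventually_ge_atTop 0] with t ht
    exact (hFTC t ht).symm
  have hint : Tendsto (fun t => ∫ s in (0 : ℝ)..t, f s) atTop (𝓝 (y' (Qinf x'))) := by
    refine (hQinf x' y').congr' ?_
    filter_upwards [eventually_ge_atTop 0] with t ht
    rw [hcov x' t ht, ← y'.intervalIntegral_comp_comm (hgx.intervalIntegrable _ _)]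
    rfl
  have h0 := eq_zero_of_tendsto_of_tendsto_integral hf hlim hint
  have hf0 : f 0 = y' (Q.op x') := by
    simp [f, dualOrbit, hT.zero]
  rw [hf0] at h0
  linarith

end Semigroup

/-! ### The reproducing kernel Hilbert space and the operator `B` -/

section RKHSLemmas

variable {X : Type u} [NormedAddCommGroup X] [NormedSpace ℝ X]

theorem istar_apply (Q : NonnegSymmOp X) (x' : StrongDual ℝ X) :
    istar Q x' = ((toPre Q x' : PreRKHS Q) : RKHS Q) := rfl

theorem inner_istar_istar (Q : NonnegSymmOp X) (x' y' : StrongDual ℝ X) :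
    inner ℝ (istar Q x') (istar Q y') = y' (Q.op x') := by
  rw [istar_apply, istar_apply, UniformSpace.Completion.inner_coe, pre_inner]

theorem denseRange_istar (Q : NonnegSymmOp X) : DenseRange (istar Q) :=
  (UniformSpace.Completion.denseRange_coe (α := PreRKHS Q)).comp
    (toPre Q).surjective.denseRange (UniformSpace.Completion.continuous_coe _)

variable [CompleteSpace X]

theorem emb_istar (Q : NonnegSymmOp X) (x' : StrongDual ℝ X) : emb Q (istar Q x') = Q.op x' :=
  ContinuousLinearMap.extend_eq (preEmb Q)
    (e := UniformSpace.Completion.toComplL (𝕜 := ℝ) (E := PreRKHS Q))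
    UniformSpace.Completion.denseRange_coe
    (UniformSpace.Completion.isUniformInducing_coe _) (toPre Q x')

/-- `i*` is the adjoint of `i`. -/
theorem inner_istar (Q : NonnegSymmOp X) (h : RKHS Q) (x' : StrongDual ℝ X) :
    inner ℝ h (istar Q x') = x' (emb Q h) := by
  refine (denseRange_istar Q).induction_on (p := fun h => inner ℝ h (istar Q x') = x' (emb Q h)) h
    (isClosed_eq (by fun_prop) (by fun_prop)) fun y' => ?_
  rw [inner_istar_istar, emb_istar]

theorem emb_injective (Q : NonnegSymmOp X) : Function.Injective (emb Q) := by
  refine (injective_iff_map_eq_zero (emb Q)).2 fun h hh => ?_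
  refine (denseRange_istar Q).eq_zero_of_inner_left ℝ fun x' => ?_
  rw [inner_istar, hh, map_zero]

variable {T : ℝ → X →L[ℝ] X} {A : X →ₗ.[ℝ] X}

/-- `i* D(A*)` is dense in `H`. -/
theorem denseRange_istar_adjSubmodule (Q : NonnegSymmOp X) (hT : IsC0ContractionSemigroup T)
    (hA : IsGenerator A T) :
    DenseRange ((istar Q).toLinearMap.comp (adjSubmodule A).subtype) := by
  have h : (LinearMap.range ((istar Q).toLinearMap.comp
      (adjSubmodule A).subtype)).topologicalClosure = ⊤ := by
    rw [Submodule.topologicalClosure_eq_top_iff, Submodule.eq_bot_iff]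
    intro k hk
    rw [Submodule.mem_orthogonal'] at hk
    refine emb_injective Q ?_
    rw [map_zero]
    refine eq_zero_of_forall_adjDomain hA hT fun x' hx' => ?_
    rw [← inner_istar]
    exact hk _ ⟨⟨x', hx'⟩, rfl⟩
  rw [Submodule.eq_top_iff'] at h
  intro k
  exact h k

/-- A linear map `q` with values in the range of `i`, bounded for the norm of `H`, factors through
the map `S` with dense range. -/
theorem exists_factor_of_denseRange {V H X : Type*} [NormedAddCommGroup V] [NormedSpace ℝ V]
    [NormedAddCommGroup H] [NormedSpace ℝ H] [CompleteSpace H] [NormedAddCommGroup X]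
    [NormedSpace ℝ X] (D : Submodule ℝ V) (S : V →L[ℝ] H) (i : H →L[ℝ] X)
    (hi : Function.Injective i) (hS : DenseRange fun x : D => S x) (q : V → X)
    (hadd : ∀ x ∈ D, ∀ y ∈ D, q (x + y) = q x + q y)
    (hsmul : ∀ (r : ℝ), ∀ x ∈ D, q (r • x) = r • q x)
    (hq : ∃ c : ℝ, 0 < c ∧ ∀ x ∈ D, ∃ h : H, i h = q x ∧ ‖h‖ ≤ c * ‖S x‖) :
    ∃ B : H →L[ℝ] H, ∀ x ∈ D, i (B (S x)) = q x := by
  obtain ⟨c, -, hc⟩ := hq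
  choose! g hg hgc using hc
  let L : D →ₗ[ℝ] H :=
    { toFun := fun x => g x
      map_add' := fun x y => hi <| by
        rw [map_add, hg _ (x + y).2, hg _ x.2, hg _ y.2, Submodule.coe_add, hadd _ x.2 _ y.2]
      map_smul' := fun r x => hi <| by
        rw [RingHom.id_apply, map_smul, hg _ (r • x).2, hg _ x.2, Submodule.coe_smul,
          hsmul r _ x.2] }
  let e : D →ₗ[ℝ] H := S.toLinearMap.comp D.subtype
  refine ⟨L.extendOfNorm e, fun x hx => ?_⟩
  have h : L.extendOfNorm e (S x) = g x :=
    LinearMap.extendOfNorm_eq (f := L) (e := e) hS ⟨c, fun y => hgc _ y.2⟩ ⟨x, hx⟩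
  rw [h, hg x hx]

/-- The operator `B` exists. -/
theorem emb_opB_istar (Q : NonnegSymmOp X) (hT : IsC0ContractionSemigroup T)
    (hA : IsGenerator A T) (Qinf : StrongDual ℝ X →L[ℝ] X)
    (hRKH : ∃ c : ℝ, 0 < c ∧ ∀ x' ∈ adjDomain A, ∃ h : RKHS Q,
      emb Q h = Qinf (adj A x') ∧ ‖h‖ ≤ c * ‖istar Q x'‖) :
    ∀ x' ∈ adjDomain A, emb Q (opB Q A Qinf (istar Q x')) = Qinf (adj A x') := by
  have hd := hA.dense_domain hT
  have hex : ∃ B : RKHS Q →L[ℝ] RKHS Q,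
      ∀ x' ∈ adjDomain A, emb Q (B (istar Q x')) = Qinf (adj A x') :=
    exists_factor_of_denseRange (adjSubmodule A) (istar Q) (emb Q) (emb_injective Q)
      (denseRange_istar_adjSubmodule Q hT hA) (fun x' => Qinf (adj A x'))
      (fun x' hx y' hy => by rw [adj_add hd hx hy, map_add])
      (fun r x' hx => by rw [adj_smul hd r hx, map_smul]) hRKH
  intro x' hx'
  rw [opB, dif_pos hex]
  exact Classical.choose_spec hex x' hx'

/-- `B + B* = -I`, by the Lyapunov equation on the dense subspace `i* D(A*)`. -/
theorem inner_opB_self {Q : NonnegSymmOp X} (hT : IsC0ContractionSemigroup T)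
    (hA : IsGenerator A T) {Qinf : StrongDual ℝ X →L[ℝ] X}
    (hQinf : ∀ x' y' : StrongDual ℝ X,
      Tendsto (fun t : ℝ => y' (covInt Q T t x')) atTop (𝓝 (y' (Qinf x'))))
    (hsymm : ∀ x' y' : StrongDual ℝ X, y' (Qinf x') = x' (Qinf y'))
    {B : RKHS Q →L[ℝ] RKHS Q}
    (hB : ∀ x' ∈ adjDomain A, emb Q (B (istar Q x')) = Qinf (adj A x')) (k : RKHS Q) :
    2 * inner ℝ (B k) k = -inner ℝ k k := by
  refine (denseRange_istar_adjSubmodule Q hT hA).induction_on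
    (p := fun k => 2 * inner ℝ (B k) k = -inner ℝ k k) k
    (isClosed_eq (by fun_prop) (by fun_prop)) fun x' => ?_
  change 2 * inner ℝ (B (istar Q x')) (istar Q x') = -inner ℝ (istar Q x') (istar Q x')
  rw [inner_istar, hB _ x'.2, inner_istar_istar, ← lyapunov Q hT hA hQinf x'.2 x'.2, hsymm]
  ring

/-- `B i* D(A*)` is dense in `H`: the range of `B` is dense because `[B k, k] = -|k|² / 2`. -/
theorem denseRange_opB_istar {Q : NonnegSymmOp X} (hT : IsC0ContractionSemigroup T)
    (hA : IsGenerator A T) {B : RKHS Q →L[ℝ] RKHS Q}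
    (hB : ∀ k, 2 * inner ℝ (B k) k = -inner ℝ k k) :
    DenseRange fun x' : adjSubmodule A => B (istar Q x') := by
  refine DenseRange.comp (g := B) ?_ (denseRange_istar_adjSubmodule Q hT hA) B.continuous
  have h : (LinearMap.range B.toLinearMap).topologicalClosure = ⊤ := by
    rw [Submodule.topologicalClosure_eq_top_iff, Submodule.eq_bot_iff]
    intro k hk
    rw [Submodule.mem_orthogonal] at hk
    have h1 : inner ℝ (B k) k = 0 := hk _ ⟨k, rfl⟩
    have h2 := hB k
    rw [h1, mul_zero, eq_comm, neg_eq_zero] at h2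
    exact inner_self_eq_zero.1 h2
  rw [Submodule.eq_top_iff'] at h
  intro k
  exact h k

end RKHSLemmas

/-! ### Bounded `C¹` functions -/

section C1b

variable {X : Type u} [NormedAddCommGroup X] [NormedSpace ℝ X]

/-- `w ∈ C_b^1(X)`: `w` is continuously differentiable, and bounded together with its derivative.
This class contains the cylindrical functions, and its closure under products and compositions
needs no bookkeeping of coordinates. -/
structure IsC1b (w : X → ℝ) : Prop where
  contDiff : ContDiff ℝ 1 w
  bdd : ∃ C, ∀ x, ‖w x‖ ≤ C
  bdd_fderiv : ∃ C, ∀ x, ‖fderiv ℝ w x‖ ≤ C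

variable {w v : X → ℝ}

theorem IsC1b.differentiable (hw : IsC1b w) : Differentiable ℝ w :=
  hw.contDiff.differentiable one_ne_zero

theorem IsC1b.continuous (hw : IsC1b w) : Continuous w := hw.contDiff.continuous

theorem IsC1b.continuous_fderiv (hw : IsC1b w) : Continuous (fderiv ℝ w) :=
  hw.contDiff.continuous_fderiv one_ne_zero

theorem IsC1b.fderiv_mul (hw : IsC1b w) (hv : IsC1b v) (x : X) :
    fderiv ℝ (fun y => w y * v y) x = w x • fderiv ℝ v x + v x • fderiv ℝ w x :=
  _root_.fderiv_fun_mul (hw.differentiable x) (hv.differentiable x)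

theorem IsC1b.mul (hw : IsC1b w) (hv : IsC1b v) : IsC1b fun x => w x * v x := by
  refine ⟨hw.contDiff.mul hv.contDiff, ?_, ?_⟩
  · obtain ⟨C, hC⟩ := hw.bdd
    obtain ⟨D, hD⟩ := hv.bdd
    refine ⟨C * D, fun x => ?_⟩
    rw [norm_mul]
    exact mul_le_mul (hC x) (hD x) (norm_nonneg _) ((norm_nonneg _).trans (hC x))
  · obtain ⟨C, hC⟩ := hw.bdd
    obtain ⟨D, hD⟩ := hv.bdd
    obtain ⟨C', hC'⟩ := hw.bdd_fderiv
    obtain ⟨D', hD'⟩ := hv.bdd_fderiv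
    refine ⟨C * D' + D * C', fun x => ?_⟩
    rw [hw.fderiv_mul hv]
    refine (norm_add_le _ _).trans (add_le_add ?_ ?_)
    · rw [norm_smul]
      exact mul_le_mul (hC x) (hD' x) (norm_nonneg _) ((norm_nonneg _).trans (hC x))
    · rw [norm_smul]
      exact mul_le_mul (hD x) (hC' x) (norm_nonneg _) ((norm_nonneg _).trans (hD x))

theorem IsC1b.fderiv_comp_real (hw : IsC1b w) {ρ : ℝ → ℝ} (hρ : ContDiff ℝ 1 ρ) (x : X) :
    fderiv ℝ (fun y => ρ (w y)) x = deriv ρ (w x) • fderiv ℝ w x :=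
  (((hρ.differentiable one_ne_zero (w x)).hasDerivAt.comp_hasFDerivAt x
    (hw.differentiable x).hasFDerivAt)).fderiv

theorem IsC1b.comp_real (hw : IsC1b w) {ρ : ℝ → ℝ} (hρ : ContDiff ℝ 1 ρ)
    (hb : ∃ C, ∀ s, ‖ρ s‖ ≤ C) (hb' : ∃ C, ∀ s, ‖deriv ρ s‖ ≤ C) :
    IsC1b fun x => ρ (w x) := by
  obtain ⟨C, hC⟩ := hb
  obtain ⟨D, hD⟩ := hb'
  obtain ⟨D', hD'⟩ := hw.bdd_fderiv
  refine ⟨hρ.comp hw.contDiff, ⟨C, fun x => hC _⟩, ⟨D * D', fun x => ?_⟩⟩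
  rw [hw.fderiv_comp_real hρ, norm_smul]
  exact mul_le_mul (hD _) (hD' x) (norm_nonneg _) ((norm_nonneg _).trans (hD 0))

theorem IsC1b.comp_clm {E : Type*} [NormedAddCommGroup E] [NormedSpace ℝ E] {φ : E → ℝ}
    (hφ : IsC1b φ) (L : X →L[ℝ] E) : IsC1b fun x => φ (L x) := by
  obtain ⟨C, hC⟩ := hφ.bdd
  obtain ⟨D, hD⟩ := hφ.bdd_fderiv
  refine ⟨hφ.contDiff.comp L.contDiff, ⟨C, fun x => hC _⟩, ⟨D * ‖L‖, fun x => ?_⟩⟩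
  have h : fderiv ℝ (fun x => φ (L x)) x = (fderiv ℝ φ (L x)).comp L :=
    ((hφ.differentiable (L x)).hasFDerivAt.comp x L.hasFDerivAt).fderiv
  rw [h]
  exact (ContinuousLinearMap.opNorm_comp_le _ _).trans
    (mul_le_mul_of_nonneg_right (hD _) (norm_nonneg _))

theorem IsCb.isC1b {n : ℕ} {φ : (Fin n → ℝ) → ℝ} {k : ℕ} (hk : 1 ≤ k) (hφ : IsCb k φ) :
    IsC1b φ := by
  obtain ⟨C, hC⟩ := hφ.2 0 (Nat.zero_le _)
  obtain ⟨D, hD⟩ := hφ.2 1 hk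
  refine ⟨hφ.1.of_le (by exact_mod_cast hk), ⟨C, fun x => ?_⟩, ⟨D, fun x => ?_⟩⟩
  · simpa using hC x
  · simpa [norm_iteratedFDeriv_one] using hD x

theorem isC1b_of_mem_FCb {f : X → ℝ} (hf : f ∈ FCb X 1) : IsC1b f := by
  obtain ⟨n, φ, x', hφ, -, hf⟩ := hf
  have : f = fun x => φ (ContinuousLinearMap.pi x' x) := funext hf
  rw [this]
  exact (hφ.isC1b le_rfl).comp_clm _

end C1b

/-! ### Gaussian integration by parts -/

section Gaussian

open ProbabilityTheory

/-- Stein's identity on the line. -/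
theorem integral_mul_gaussianReal {v : ℝ≥0} (hv : v ≠ 0) {g : ℝ → ℝ} (hg : IsC1b g) :
    ∫ s, s * g s ∂(gaussianReal 0 v) = v * ∫ s, deriv g s ∂(gaussianReal 0 v) := by
  obtain ⟨C, hC⟩ := hg.bdd
  obtain ⟨D, hD⟩ := hg.bdd_fderiv
  have hv0 : (0 : ℝ) < v := lt_of_le_of_ne v.2 fun h => hv (NNReal.coe_injective h.symm)
  have hg' : Continuous (deriv g) := hg.contDiff.continuous_deriv le_rfl
  have hD' : ∀ s, ‖deriv g s‖ ≤ D := fun s => by rw [norm_deriv_eq_norm_fderiv]; exact hD s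
  have hp : Integrable (gaussianPDFReal 0 v) := integrable_gaussianPDFReal 0 v
  have hsp : Integrable fun s : ℝ => s * gaussianPDFReal 0 v s := by
    have h := (integrable_mul_exp_neg_mul_sq (b := (2 * (v : ℝ))⁻¹) (by positivity)).const_mul
      (√(2 * Real.pi * v))⁻¹
    refine h.congr (ae_of_all _ fun s => ?_)
    simp only [gaussianPDFReal]
    rw [show -(s - 0) ^ 2 / (2 * (v : ℝ)) = -(2 * (v : ℝ))⁻¹ * s ^ 2 by
      field_simp; ring]
    ring
  have hI1 : Integrable fun s : ℝ => gaussianPDFReal 0 v s * (s * g s) := by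
    refine ((hsp.bdd_mul hg.continuous.aestronglyMeasurable (ae_of_all _ hC)).congr
      (ae_of_all _ fun s => ?_))
    simp only; ring
  have hI2 : Integrable fun s : ℝ => gaussianPDFReal 0 v s * deriv g s := by
    refine ((hp.bdd_mul hg'.aestronglyMeasurable (ae_of_all _ hD')).congr
      (ae_of_all _ fun s => ?_))
    simp only; ring
  have hI3 : Integrable fun s : ℝ => v * (gaussianPDFReal 0 v s * g s) := by
    refine ((hp.bdd_mul hg.continuous.aestronglyMeasurable (ae_of_all _ hC)).congr
      (ae_of_all _ fun s => ?_)).const_mul (v : ℝ)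
    simp only; ring
  have hder : ∀ s : ℝ, HasDerivAt (fun s => (v : ℝ) * (gaussianPDFReal 0 v s * g s))
      (v * (gaussianPDFReal 0 v s * deriv g s) - gaussianPDFReal 0 v s * (s * g s)) s := by
    intro s
    have h1 : HasDerivAt (gaussianPDFReal 0 v) (-(s / v) * gaussianPDFReal 0 v s) s := by
      have h2 : HasDerivAt (fun s : ℝ => -(s - 0) ^ 2 / (2 * (v : ℝ))) (-(s / v)) s := by
        have h3 := ((((hasDerivAt_id s).sub_const 0).pow 2).neg).div_const (2 * (v : ℝ))
        refine h3.congr_deriv ?_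
        simp; field_simp
      refine (h2.exp.const_mul (√(2 * Real.pi * v))⁻¹).congr_deriv ?_
      simp only [gaussianPDFReal]
      ring
    have h4 := (h1.mul (hg.differentiable s).hasDerivAt).const_mul (v : ℝ)
    refine h4.congr_deriv ?_
    field_simp
    ring
  have h := integral_eq_zero_of_hasDerivAt_of_integrable hder
    ((hI2.const_mul _).sub hI1) hI3
  rw [integral_sub (hI2.const_mul _) hI1, integral_const_mul] at h
  rw [integral_gaussianReal_eq_integral_smul hv, integral_gaussianReal_eq_integral_smul hv]
  simp only [smul_eq_mul]
  linarith

variable {X : Type u} [NormedAddCommGroup X] [NormedSpace ℝ X]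

/-- The map `(x, s) ↦ x - σ⁻² ⟨x, y'⟩ h + σ⁻² s h`, which replaces the coordinate `⟨x, y'⟩` by `s`
when `⟨h, y'⟩ = σ²`. -/
noncomputable def replaceCoord (y' : StrongDual ℝ X) (h : X) : X × ℝ →L[ℝ] X :=
  ContinuousLinearMap.fst ℝ X ℝ +
    ((y' h)⁻¹ • (ContinuousLinearMap.snd ℝ X ℝ -
      y'.comp (ContinuousLinearMap.fst ℝ X ℝ))).smulRight h

theorem replaceCoord_apply (y' : StrongDual ℝ X) (h : X) (p : X × ℝ) :
    replaceCoord y' h p = p.1 + ((y' h)⁻¹ * (p.2 - y' p.1)) • h := rfl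

variable [MeasurableSpace X] {μ : Measure X}

theorem IsCentredGaussian.symm {R : StrongDual ℝ X → X} (hμ : IsCentredGaussian μ R)
    (x' y' : StrongDual ℝ X) : y' (R x') = x' (R y') := by
  rw [hμ.cov, hμ.cov]
  simp only [mul_comm]

variable [BorelSpace X] {R : StrongDual ℝ X →L[ℝ] X}

theorem IsCentredGaussian.charFunDual_eq {R : StrongDual ℝ X → X} (hμ : IsCentredGaussian μ R)
    (z' : StrongDual ℝ X) :
    charFunDual μ z' = Complex.exp (-((z' (R z') : ℝ) : ℂ) / 2) := by
  have := hμ.gaussian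
  have hvar : Var[z'; μ] = z' (R z') := by
    rw [variance_of_integral_eq_zero z'.continuous.aemeasurable (hμ.centred z'), hμ.cov]
    simp only [sq]
  rw [IsGaussian.charFunDual_eq, hvar]
  congr 1
  rw [integral_complex_ofReal, hμ.centred]
  simp [neg_div]

theorem charFunDual_gaussianReal_zero (v : ℝ≥0) (L : StrongDual ℝ ℝ) :
    charFunDual (gaussianReal 0 v) L = Complex.exp (-((v * L 1 ^ 2 : ℝ) : ℂ) / 2) := by
  have h := charFun_gaussianReal (μ := 0) (v := v) (L 1)
  rw [charFun_apply_real] at h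
  rw [charFunDual_apply]
  have hL : ∀ s : ℝ, L s = L 1 * s := fun s => by
    rw [mul_comm, ← smul_eq_mul, ← map_smul, smul_eq_mul, mul_one]
  have e : (fun s : ℝ => Complex.exp (L s * Complex.I)) =
      fun s : ℝ => Complex.exp (L 1 * s * Complex.I) := by
    funext s
    rw [hL s, Complex.ofReal_mul]
  rw [e, h]
  congr 1
  push_cast
  ring

variable [SecondCountableTopology X] [CompleteSpace X]

/-- Under `μ`, the coordinate `⟨x, y'⟩` is independent of `x - σ⁻² ⟨x, y'⟩ R y'`, and has the law
`N(0, σ²)`, where `σ² = ⟨R y', y'⟩`. -/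
theorem map_replaceCoord (hμ : IsCentredGaussian μ R) {y' : StrongDual ℝ X} {v : ℝ≥0}
    (hv : v ≠ 0) (hvy : y' (R y') = v) :
    (μ.prod (gaussianReal 0 v)).map (replaceCoord y' (R y')) = μ := by
  have := hμ.gaussian
  have hv0 : (v : ℝ) ≠ 0 := fun h => hv (NNReal.coe_injective h)
  have : IsProbabilityMeasure ((μ.prod (gaussianReal 0 v)).map (replaceCoord y' (R y'))) :=
    Measure.isProbabilityMeasure_map (replaceCoord y' (R y')).continuous.aemeasurable
  refine Measure.ext_of_charFunDual (funext fun z' => ?_)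
  rw [charFunDual_map, charFunDual_prod, hμ.charFunDual_eq, hμ.charFunDual_eq,
    charFunDual_gaussianReal_zero, ← Complex.exp_add]
  congr 1
  set b : ℝ := z' (R y') with hb
  have e1 : (z'.comp (replaceCoord y' (R y'))).comp (ContinuousLinearMap.inl ℝ X ℝ) =
      z' - ((v : ℝ)⁻¹ * b) • y' := by
    ext x
    simp [replaceCoord_apply, hvy, ← hb]
    ring
  have e2 : (z'.comp (replaceCoord y' (R y'))).comp (ContinuousLinearMap.inr ℝ X ℝ) 1 =
      (v : ℝ)⁻¹ * b := by
    simp [replaceCoord_apply, hvy, ← hb]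
  rw [e1, e2]
  simp only [map_sub, map_smul, sub_apply, smul_apply, smul_eq_mul, hvy, ← hb,
    hμ.symm z' y']
  have hvC : (v : ℂ) ≠ 0 := by exact_mod_cast hv0
  push_cast
  field_simp
  ring

/-- Gaussian integration by parts: `∫ ⟨x, y'⟩ w(x) dμ = ∫ ⟨R y', D w(x)⟩ dμ`. -/
theorem integral_dual_mul (hμ : IsCentredGaussian μ R) {y' : StrongDual ℝ X}
    (hy' : 0 < y' (R y')) {w : X → ℝ} (hw : IsC1b w) :
    ∫ x, y' x * w x ∂μ = ∫ x, fderiv ℝ w x (R y') ∂μ := by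
  have := hμ.gaussian
  obtain ⟨C, hC⟩ := hw.bdd
  obtain ⟨D, hD⟩ := hw.bdd_fderiv
  let v : ℝ≥0 := ⟨y' (R y'), hy'.le⟩
  have hvy : y' (R y') = v := rfl
  have hv : v ≠ 0 := fun h => hy'.ne' (by rw [hvy, h]; rfl)
  have hv0 : (v : ℝ) ≠ 0 := fun h => hv (NNReal.coe_injective h)
  have hmap := map_replaceCoord hμ hv hvy
  have hI1 : Integrable (fun x => y' x * w x) μ :=
    (IsGaussian.integrable_dual μ y').mul_bdd hw.continuous.aestronglyMeasurable (ae_of_all _ hC)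
  have hI2 : Integrable (fun x => fderiv ℝ w x (R y')) μ := by
    refine Integrable.of_bound (C := D * ‖R y'‖)
      (hw.continuous_fderiv.clm_apply continuous_const).aestronglyMeasurable
      (ae_of_all _ fun x => ?_)
    exact (fderiv ℝ w x).le_of_opNorm_le (hD x) _
  have key : ∀ {f : X → ℝ}, Integrable f μ →
      ∫ x, f x ∂μ = ∫ x, ∫ s, f (replaceCoord y' (R y') (x, s)) ∂(gaussianReal 0 v) ∂μ := by
    intro f hf
    have hm : AEMeasurable (replaceCoord y' (R y')) (μ.prod (gaussianReal 0 v)) :=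
      (replaceCoord y' (R y')).continuous.aemeasurable
    have h0 := hf
    rw [← hmap] at h0
    have h1 := integral_map hm h0.aestronglyMeasurable
    rw [hmap] at h1
    rw [h1]
    exact integral_prod _ ((integrable_map_measure h0.aestronglyMeasurable hm).1 h0)
  rw [key hI1, key hI2]
  refine integral_congr_ae (ae_of_all _ fun x => ?_)
  -- for fixed `x`, Stein's identity applies to `w` along the line `c` with direction `R y'`
  let c : ℝ → X := fun s => replaceCoord y' (R y') (x, s)
  have hcder : ∀ s, HasDerivAt c ((v : ℝ)⁻¹ • R y') s := by
    intro s
    have h1 : HasDerivAt (fun s : ℝ => (v : ℝ)⁻¹ * (s - y' x)) (v : ℝ)⁻¹ s := by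
      simpa using ((hasDerivAt_id s).sub_const (y' x)).const_mul (v : ℝ)⁻¹
    exact (h1.smul_const (R y')).const_add x
  have hgder : ∀ s, HasDerivAt (fun s => w (c s)) (fderiv ℝ w (c s) ((v : ℝ)⁻¹ • R y')) s :=
    fun s => (hw.differentiable (c s)).hasFDerivAt.comp_hasDerivAt s (hcder s)
  have hc : ContDiff ℝ 1 c :=
    (replaceCoord y' (R y')).contDiff.comp (contDiff_const.prodMk contDiff_id)
  have hg : IsC1b fun s => w (c s) := by
    refine ⟨hw.contDiff.comp hc, ⟨C, fun s => hC _⟩, ⟨D * ‖(v : ℝ)⁻¹ • R y'‖, fun s => ?_⟩⟩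
    rw [← norm_deriv_eq_norm_fderiv, (hgder s).deriv]
    exact (fderiv ℝ w (c s)).le_of_opNorm_le (hD _) _
  have h := integral_mul_gaussianReal hv hg
  simp only [fun s => (hgder s).deriv, map_smul, smul_eq_mul] at h
  rw [integral_const_mul, mul_inv_cancel_left₀ hv0] at h
  refine Eq.trans (integral_congr_ae (ae_of_all _ fun s => ?_)) h
  have : y' (replaceCoord y' (R y') (x, s)) = s := by
    rw [replaceCoord_apply, map_add, map_smul, hvy, smul_eq_mul]
    field_simp
    ring
  simp only [this, c]

end Gaussian

/-! ### Cylindrical functions separate integrable functions -/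

section Totality

variable {X : Type u} [NormedAddCommGroup X] [NormedSpace ℝ X]

theorem comp_dual_mem_FCb {ρ : ℝ → ℝ} (hρ : ContDiff ℝ 1 ρ) (hb : ∀ s, ‖ρ s‖ ≤ 1)
    (hb' : ∀ s, ‖deriv ρ s‖ ≤ 1) (z' : StrongDual ℝ X) : (fun x => ρ (z' x)) ∈ FCb X 1 := by
  have h1 : IsC1b ρ :=
    ⟨hρ, ⟨1, hb⟩, ⟨1, fun s => by rw [← norm_deriv_eq_norm_fderiv]; exact hb' s⟩⟩
  have h2 := h1.comp_clm (ContinuousLinearMap.proj (R := ℝ) (φ := fun _ : Fin 1 => ℝ) 0)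
  obtain ⟨C, hC⟩ := h2.bdd
  obtain ⟨D, hD⟩ := h2.bdd_fderiv
  refine ⟨1, fun ξ => ρ (ξ 0), fun _ => z', ⟨h2.contDiff, fun j hj => ?_⟩, fun _ => mem_univ _,
    fun x => rfl⟩
  interval_cases j
  · exact ⟨C, fun ξ => by simpa using hC ξ⟩
  · exact ⟨D, fun ξ => by simpa [norm_iteratedFDeriv_one] using hD ξ⟩

theorem cos_dual_mem_FCb (z' : StrongDual ℝ X) : (fun x => Real.cos (z' x)) ∈ FCb X 1 :=
  comp_dual_mem_FCb Real.contDiff_cos (fun s => by simpa using Real.abs_cos_le_one s)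
    (fun s => by simpa using Real.abs_sin_le_one s) z'

theorem sin_dual_mem_FCb (z' : StrongDual ℝ X) : (fun x => Real.sin (z' x)) ∈ FCb X 1 :=
  comp_dual_mem_FCb Real.contDiff_sin (fun s => by simpa using Real.abs_sin_le_one s)
    (fun s => by simpa using Real.abs_cos_le_one s) z'

variable [MeasurableSpace X] [BorelSpace X] [SecondCountableTopology X] [CompleteSpace X]
  {γ : Measure X}

/-- An integrable function that is orthogonal to `FC_b^1(X)` vanishes: its positive and negative
parts are the densities of two finite measures with the same characteristic function. -/
theorem ae_eq_zero_of_forall_FCb [IsFiniteMeasure γ] {g : X → ℝ} (hg : Integrable g γ)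
    (h : ∀ ψ ∈ FCb X 1, ∫ x, g x * ψ x ∂γ = 0) : g =ᵐ[γ] 0 := by
  have hmeas : AEMeasurable (fun x => ENNReal.ofReal (g x)) γ := hg.aemeasurable.ennreal_ofReal
  have hmeas' : AEMeasurable (fun x => ENNReal.ofReal (-g x)) γ :=
    hg.neg.aemeasurable.ennreal_ofReal
  have := isFiniteMeasure_withDensity_ofReal hg.hasFiniteIntegral
  have : IsFiniteMeasure (γ.withDensity fun x => ENNReal.ofReal (-g x)) :=
    isFiniteMeasure_withDensity_ofReal hg.neg.hasFiniteIntegral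
  have key : γ.withDensity (fun x => ENNReal.ofReal (g x)) =
      γ.withDensity (fun x => ENNReal.ofReal (-g x)) := by
    refine Measure.ext_of_charFunDual (funext fun z' => ?_)
    rw [charFunDual_apply, charFunDual_apply,
      integral_withDensity_eq_integral_toReal_smul₀ hmeas (ae_of_all _ fun _ => by simp),
      integral_withDensity_eq_integral_toReal_smul₀ hmeas' (ae_of_all _ fun _ => by simp),
      ← sub_eq_zero]
    have hexp : Continuous fun x : X => Complex.exp (z' x * Complex.I) := by fun_prop
    have hexp1 : ∀ x : X, ‖Complex.exp (z' x * Complex.I)‖ ≤ 1 := fun x => by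
      rw [Complex.norm_exp_ofReal_mul_I]
    have hI : ∀ {f : X → ℝ}, Integrable f γ →
        Integrable (fun x => f x • Complex.exp (z' x * Complex.I)) γ := fun hf =>
      hf.smul_bdd 1 hexp.aestronglyMeasurable (ae_of_all _ hexp1)
    simp only [ENNReal.toReal_ofReal']
    rw [← integral_sub (hI hg.pos_part) (hI hg.neg_part)]
    have hc := h _ (cos_dual_mem_FCb z')
    have hs := h _ (sin_dual_mem_FCb z')
    have hIc : Integrable (fun x => g x * Real.cos (z' x)) γ :=
      hg.mul_bdd (c := 1) (by fun_prop) (ae_of_all _ fun x => Real.abs_cos_le_one _)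
    have hIs : Integrable (fun x => g x * Real.sin (z' x)) γ :=
      hg.mul_bdd (c := 1) (by fun_prop) (ae_of_all _ fun x => Real.abs_sin_le_one _)
    calc _ = ∫ x, (((g x * Real.cos (z' x) : ℝ) : ℂ) +
          ((g x * Real.sin (z' x) : ℝ) : ℂ) * Complex.I) ∂γ := by
          refine integral_congr_ae (ae_of_all _ fun x => ?_)
          have hpm : max (g x) 0 - max (-g x) 0 = g x := by
            rcases le_total 0 (g x) with h0 | h0 <;> simp [h0]
          simp only
          rw [← sub_smul, hpm, Complex.exp_mul_I]
          simp
          ring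
      _ = 0 := by
          rw [integral_add hIc.ofReal (hIs.ofReal.mul_const _), integral_mul_const,
            integral_complex_ofReal, integral_complex_ofReal, hc, hs]
          simp
  have h2 := (withDensity_eq_iff hmeas hmeas' hg.lintegral_lt_top.ne).1 key
  filter_upwards [h2] with x hx
  rcases le_total 0 (g x) with h0 | h0
  · rw [ENNReal.ofReal_of_nonpos (neg_nonpos.2 h0)] at hx
    exact le_antisymm (ENNReal.ofReal_eq_zero.1 hx) h0
  · rw [ENNReal.ofReal_of_nonpos h0] at hx
    exact le_antisymm h0 (neg_nonpos.1 (ENNReal.ofReal_eq_zero.1 hx.symm))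

end Totality

/-! ### Integration by parts and closability of `D_H` -/

section Closability

theorem ae_eq_zero_of_forall_inner {X : Type*} [MeasurableSpace X] {γ : Measure X} {H : Type*}
    [NormedAddCommGroup H] [InnerProductSpace ℝ H] [CompleteSpace H] {G : X → H}
    (hG : Integrable G γ) {ι : Type*} {κ : ι → H}
    (hκ : DenseRange κ) (h : ∀ i, (fun x => inner ℝ (κ i) (G x)) =ᵐ[γ] 0) : G =ᵐ[γ] 0 := by
  refine hG.ae_eq_zero_of_forall_setIntegral_eq_zero fun s _ _ => ?_
  refine hκ.eq_zero_of_inner_right ℝ fun i => ?_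
  rw [← integral_inner hG.integrableOn]
  exact integral_eq_zero_of_ae (ae_restrict_of_ae (h i))

theorem tendsto_integral_inner {X : Type*} [MeasurableSpace X] {γ : Measure X} {H : Type*}
    [NormedAddCommGroup H] [InnerProductSpace ℝ H] {F G : X → H} {f g : ℕ → X → H}
    (hF : MemLp F 2 γ) (hG : MemLp G 2 γ) (hf : ∀ n, MemLp (f n) 2 γ) (hg : ∀ n, MemLp (g n) 2 γ)
    (hfF : Tendsto (fun n => eLpNorm (f n - F) 2 γ) atTop (𝓝 0))
    (hgG : Tendsto (fun n => eLpNorm (g n - G) 2 γ) atTop (𝓝 0)) :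
    Tendsto (fun n => ∫ x, inner ℝ (f n x) (g n x) ∂γ) atTop
      (𝓝 (∫ x, inner ℝ (F x) (G x) ∂γ)) := by
  have h1 := (Lp.tendsto_Lp_iff_tendsto_eLpNorm'' f hf F hF).2 hfF
  have h2 := (Lp.tendsto_Lp_iff_tendsto_eLpNorm'' g hg G hG).2 hgG
  have h3 : ∀ {f g : X → H} (hf : MemLp f 2 γ) (hg : MemLp g 2 γ),
      inner ℝ (hf.toLp f) (hg.toLp g) = ∫ x, inner ℝ (f x) (g x) ∂γ := by
    intro f g hf hg
    rw [L2.inner_def]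
    refine integral_congr_ae ?_
    filter_upwards [hf.coeFn_toLp, hg.coeFn_toLp] with x hx hx'
    rw [hx, hx']
  simpa only [h3] using h1.inner (𝕜 := ℝ) h2

variable {X : Type u} [NormedAddCommGroup X] [NormedSpace ℝ X]

theorem IsC1b.continuous_gradCyl {w : X → ℝ} (hw : IsC1b w) (Q : NonnegSymmOp X) :
    Continuous (gradCyl Q w) :=
  (istar Q).continuous.comp hw.continuous_fderiv

theorem IsC1b.bdd_gradCyl {w : X → ℝ} (hw : IsC1b w) (Q : NonnegSymmOp X) :
    ∃ C, ∀ x, ‖gradCyl Q w x‖ ≤ C := by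
  obtain ⟨D, hD⟩ := hw.bdd_fderiv
  exact ⟨‖istar Q‖ * D, fun x => (istar Q).le_opNorm_of_le (hD x)⟩

theorem IsC1b.gradCyl_mul {w v : X → ℝ} (hw : IsC1b w) (hv : IsC1b v) (Q : NonnegSymmOp X)
    (x : X) : gradCyl Q (fun y => w y * v y) x = w x • gradCyl Q v x + v x • gradCyl Q w x := by
  simp only [gradCyl, hw.fderiv_mul hv, map_add, map_smul]

variable [MeasurableSpace X] {γ : Measure X}

theorem sobolevGrad_spec {Q : NonnegSymmOp X} {p : ℝ≥0∞} {f : X → ℝ} (h : MemSobolev Q γ p f) :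
    HasSobolevGrad Q γ p f (sobolevGrad Q γ p f) := by
  rw [sobolevGrad, dif_pos h]
  exact Classical.choose_spec h

variable [BorelSpace X]

theorem IsC1b.memLp [IsFiniteMeasure γ] {w : X → ℝ} (hw : IsC1b w) (p : ℝ≥0∞) :
    MemLp w p γ := by
  obtain ⟨C, hC⟩ := hw.bdd
  exact MemLp.of_bound hw.continuous.aestronglyMeasurable C (ae_of_all _ hC)

variable [SecondCountableTopology X]

theorem IsC1b.memLp_gradCyl [IsFiniteMeasure γ] {w : X → ℝ} (hw : IsC1b w) (Q : NonnegSymmOp X)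
    (p : ℝ≥0∞) : MemLp (gradCyl Q w) p γ := by
  obtain ⟨C, hC⟩ := hw.bdd_gradCyl Q
  exact MemLp.of_bound (hw.continuous_gradCyl Q).aestronglyMeasurable C (ae_of_all _ hC)

theorem HasSobolevGrad.mono_exponent [IsProbabilityMeasure γ] {Q : NonnegSymmOp X} {p q : ℝ≥0∞}
    {f : X → ℝ} {G : X → RKHS Q} (hpq : p ≤ q) (h : HasSobolevGrad Q γ q f G) :
    HasSobolevGrad Q γ p f G := by
  obtain ⟨hf, hG, F, hFm, hFf, hFG⟩ := h
  refine ⟨hf.mono_exponent hpq, hG.mono_exponent hpq, F, hFm, ?_, ?_⟩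
  · exact tendsto_of_tendsto_of_tendsto_of_le_of_le tendsto_const_nhds hFf (fun _ => zero_le)
      fun n => eLpNorm_le_eLpNorm_of_exponent_le hpq
        ((isC1b_of_mem_FCb (hFm n)).continuous.aestronglyMeasurable.sub hf.aestronglyMeasurable)
  · exact tendsto_of_tendsto_of_tendsto_of_le_of_le tendsto_const_nhds hFG (fun _ => zero_le)
      fun n => eLpNorm_le_eLpNorm_of_exponent_le hpq
        (((isC1b_of_mem_FCb (hFm n)).continuous_gradCyl Q).aestronglyMeasurable.sub
          hG.aestronglyMeasurable)

theorem hasSobolevGrad_of_mem_FCb [IsFiniteMeasure γ] (Q : NonnegSymmOp X) (p : ℝ≥0∞) {u : X → ℝ}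
    (hu : u ∈ FCb X 1) : HasSobolevGrad Q γ p u (gradCyl Q u) :=
  ⟨(isC1b_of_mem_FCb hu).memLp p, (isC1b_of_mem_FCb hu).memLp_gradCyl Q p, fun _ => u,
    fun _ => hu, by simp, by simp⟩

/-- `β` is the divergence of the constant field `κ ∈ H` for `γ`, with the sign that makes
`∫ [κ, D_H w]_H dγ = ∫ β w dγ` for all `w ∈ C_b^1(X)`. -/
structure HasDivergence (Q : NonnegSymmOp X) (γ : Measure X) (κ : RKHS Q) (β : X → ℝ) : Prop where
  memLp : MemLp β 2 γ
  integral_eq : ∀ w : X → ℝ, IsC1b w →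
    ∫ x, inner ℝ κ (gradCyl Q w x) ∂γ = ∫ x, β x * w x ∂γ

/-- Integration by parts extends to Sobolev functions, tested against `C_b^1(X)`. -/
theorem HasDivergence.integral_sobolev [IsFiniteMeasure γ] {Q : NonnegSymmOp X} {κ : RKHS Q}
    {β : X → ℝ} (hβ : HasDivergence Q γ κ β) {f : X → ℝ} {G : X → RKHS Q}
    (hf : HasSobolevGrad Q γ 2 f G) {ψ : X → ℝ} (hψ : IsC1b ψ) :
    ∫ x, inner ℝ κ (G x) * ψ x ∂γ =
      ∫ x, (β x * ψ x - inner ℝ κ (gradCyl Q ψ x)) * f x ∂γ := by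
  obtain ⟨hf2, hG2, F, hF, hFf, hFG⟩ := hf
  have hFc : ∀ n, IsC1b (F n) := fun n => isC1b_of_mem_FCb (hF n)
  obtain ⟨C, hC⟩ := hψ.bdd
  have hψκ : MemLp (fun x => ψ x • κ) 2 γ :=
    MemLp.of_bound (hψ.continuous.smul continuous_const).aestronglyMeasurable (C * ‖κ‖)
      (ae_of_all _ fun x => by
        rw [norm_smul]; exact mul_le_mul_of_nonneg_right (hC x) (norm_nonneg _))
  have hβψ : MemLp (fun x => β x * ψ x) 2 γ :=
    hβ.memLp.of_le_mul (hβ.memLp.aestronglyMeasurable.mul hψ.continuous.aestronglyMeasurable)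
      (c := C) (ae_of_all _ fun x => by
        rw [norm_mul, mul_comm]; exact mul_le_mul_of_nonneg_right (hC x) (norm_nonneg _))
  have hm : MemLp (fun x => β x * ψ x - inner ℝ κ (gradCyl Q ψ x)) 2 γ :=
    hβψ.sub ((hψ.memLp_gradCyl Q 2).const_inner κ)
  have h1 := tendsto_integral_inner hψκ hG2 (fun _ => hψκ) (fun n => (hFc n).memLp_gradCyl Q 2)
    (by simp) hFG
  have h2 := tendsto_integral_inner hm hf2 (fun _ => hm) (fun n => (hFc n).memLp 2) (by simp) hFf
  -- the product rule for `F n * ψ`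
  have h3 : ∀ n, ∫ x, inner ℝ (ψ x • κ) (gradCyl Q (F n) x) ∂γ =
      ∫ x, inner ℝ (β x * ψ x - inner ℝ κ (gradCyl Q ψ x)) (F n x) ∂γ := by
    intro n
    have h4 := hβ.integral_eq _ ((hFc n).mul hψ)
    have hI1 : Integrable (fun x => inner ℝ (ψ x • κ) (gradCyl Q (F n) x)) γ :=
      memLp_one_iff_integrable.1 <| by
        obtain ⟨D, hD⟩ := (hFc n).bdd_gradCyl Q
        refine MemLp.of_bound (((hψ.continuous.smul continuous_const).inner
          ((hFc n).continuous_gradCyl Q)).aestronglyMeasurable) (C * ‖κ‖ * D)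
          (ae_of_all _ fun x => ?_)
        refine (norm_inner_le_norm _ _).trans ?_
        rw [norm_smul]
        exact mul_le_mul (mul_le_mul_of_nonneg_right (hC x) (norm_nonneg _)) (hD x)
          (norm_nonneg _) (mul_nonneg ((norm_nonneg _).trans (hC x)) (norm_nonneg _))
    have hI2 : Integrable (fun x => inner ℝ κ (gradCyl Q ψ x) * F n x) γ :=
      ((hψ.memLp_gradCyl Q 2).const_inner κ).integrable_mul ((hFc n).memLp 2)
    have hI3 : Integrable (fun x => β x * ψ x * F n x) γ :=
      hβψ.integrable_mul ((hFc n).memLp 2)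
    have h5 : ∀ x, inner ℝ κ (gradCyl Q (fun y => F n y * ψ y) x) =
        inner ℝ κ (gradCyl Q ψ x) * F n x + inner ℝ (ψ x • κ) (gradCyl Q (F n) x) := fun x => by
      rw [(hFc n).gradCyl_mul hψ, inner_add_right, real_inner_smul_right, real_inner_smul_right,
        real_inner_smul_left]
      ring
    simp only [h5] at h4
    rw [integral_add hI2 hI1] at h4
    have h6 : ∫ x, inner ℝ (β x * ψ x - inner ℝ κ (gradCyl Q ψ x)) (F n x) ∂γ =
        ∫ x, β x * ψ x * F n x ∂γ - ∫ x, inner ℝ κ (gradCyl Q ψ x) * F n x ∂γ := by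
      rw [← integral_sub hI3 hI2]
      refine integral_congr_ae (ae_of_all _ fun x => ?_)
      simp
      ring
    have h7 : ∫ x, β x * (F n x * ψ x) ∂γ = ∫ x, β x * ψ x * F n x ∂γ :=
      integral_congr_ae (ae_of_all _ fun x => by ring)
    rw [h6, ← h7, ← h4]
    ring
  simp only [h3] at h1
  have h4 := tendsto_nhds_unique h1 h2
  calc _ = ∫ x, inner ℝ (ψ x • κ) (G x) ∂γ :=
        integral_congr_ae (ae_of_all _ fun x => by
          simp only [real_inner_smul_left]; ring)
    _ = _ := h4
    _ = _ := integral_congr_ae (ae_of_all _ fun x => by simp; ring)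

variable [CompleteSpace X]

/-- `D_H` is closable in `L²(γ)` when `γ` has divergences along a dense set of directions. -/
theorem HasSobolevGrad.ae_unique [IsFiniteMeasure γ] {Q : NonnegSymmOp X} {ι : Type*}
    {κ : ι → RKHS Q} (hκ : DenseRange κ) (hβ : ∀ i, ∃ β, HasDivergence Q γ (κ i) β)
    {f : X → ℝ} {G G' : X → RKHS Q} (hG : HasSobolevGrad Q γ 2 f G)
    (hG' : HasSobolevGrad Q γ 2 f G') : G =ᵐ[γ] G' := by
  have hI : Integrable (G - G') γ := (hG.2.1.sub hG'.2.1).integrable one_le_two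
  have h : G - G' =ᵐ[γ] 0 := by
    refine ae_eq_zero_of_forall_inner hI hκ fun i => ?_
    obtain ⟨β, hβ⟩ := hβ i
    refine ae_eq_zero_of_forall_FCb (hI.const_inner _) fun ψ hψ => ?_
    have hψ' := isC1b_of_mem_FCb hψ
    have hi : ∀ {K : X → RKHS Q}, MemLp K 2 γ →
        Integrable (fun x => inner ℝ (κ i) (K x) * ψ x) γ := fun hK =>
      (hK.const_inner (κ i)).integrable_mul (hψ'.memLp 2)
    calc _ = ∫ x, (inner ℝ (κ i) (G x) * ψ x - inner ℝ (κ i) (G' x) * ψ x) ∂γ :=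
          integral_congr_ae (ae_of_all _ fun x => by
            simp only [Pi.sub_apply, inner_sub_right]; ring)
      _ = 0 := by
          rw [integral_sub (hi hG.2.1) (hi hG'.2.1), hβ.integral_sobolev hG hψ',
            hβ.integral_sobolev hG' hψ', sub_self]
  filter_upwards [h] with x hx
  exact sub_eq_zero.1 hx

end Closability

/-! ### Exponential integrability of the weight -/

section Weight

open ProbabilityTheory

variable {X : Type u} [NormedAddCommGroup X] [NormedSpace ℝ X]

/-- A proper lower semicontinuous convex function has a continuous affine minorant: separate its
epigraph from a point below the graph. -/
theorem IsProperLscConvex.exists_affine_le {U : X → EReal} (hU : IsProperLscConvex U) :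
    ∃ (a' : StrongDual ℝ X) (b : ℝ), ∀ x, ((a' x + b : ℝ) : EReal) ≤ U x := by
  obtain ⟨x₀, hx₀⟩ := hU.proper
  obtain ⟨t, ht⟩ : ∃ t : ℝ, U x₀ = t := ⟨(U x₀).toReal, (EReal.coe_toReal hx₀ (hU.ne_bot x₀)).symm⟩
  have hclosed : IsClosed {z : X × ℝ | U z.1 ≤ (z.2 : EReal)} :=
    hU.lsc.isClosed_epigraph.preimage
      (continuous_fst.prodMk (continuous_coe_real_ereal.comp continuous_snd))
  have hnot : (x₀, t - 1) ∉ {z : X × ℝ | U z.1 ≤ (z.2 : EReal)} := by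
    simp only [mem_ofPred_eq, ht, EReal.coe_le_coe_iff, not_le]
    linarith
  obtain ⟨f, c, hf₀, hf⟩ := geometric_hahn_banach_point_closed hU.convex hclosed hnot
  have hsplit : ∀ (x : X) (r : ℝ),
      f (x, r) = f.comp (ContinuousLinearMap.inl ℝ X ℝ) x + r * f (0, 1) := by
    intro x r
    have : (x, r) = (x, (0 : ℝ)) + r • ((0 : X), (1 : ℝ)) := by simp
    rw [this, map_add, map_smul]
    rfl
  have ha : 0 < f (0, 1) := by
    have h1 := hf (x₀, t) (by simp [ht])
    rw [hsplit] at h1 hf₀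
    nlinarith
  refine ⟨-(f (0, 1))⁻¹ • f.comp (ContinuousLinearMap.inl ℝ X ℝ), (f (0, 1))⁻¹ * c, fun x => ?_⟩
  by_cases hx : U x = ⊤
  · rw [hx]
    exact le_top
  · obtain ⟨r, hr⟩ : ∃ r : ℝ, U x = r := ⟨(U x).toReal, (EReal.coe_toReal hx (hU.ne_bot x)).symm⟩
    have h1 := hf (x, r) (by simp [hr])
    rw [hsplit] at h1
    rw [hr, EReal.coe_le_coe_iff]
    simp only [smul_apply, smul_eq_mul]
    rw [neg_mul, neg_add_eq_sub, ← mul_sub, inv_mul_le_iff₀ ha]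
    linarith

variable [MeasurableSpace X] [BorelSpace X] {μ : Measure X}

theorem memLp_exp_dual [IsGaussian μ] (a' : StrongDual ℝ X) (b : ℝ) :
    MemLp (fun x => Real.exp (a' x + b)) 2 μ := by
  have hc : Continuous fun x => Real.exp (a' x + b) := by fun_prop
  refine (memLp_two_iff_integrable_sq hc.aestronglyMeasurable).2 ?_
  have h1 : Integrable (fun s : ℝ => Real.exp (2 * s)) (μ.map a') := by
    rw [IsGaussian.map_eq_gaussianReal a']
    exact integrable_exp_mul_gaussianReal 2
  have h2 := (h1.comp_aemeasurable a'.continuous.aemeasurable).const_mul (Real.exp (2 * b))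
  refine h2.congr (ae_of_all _ fun x => ?_)
  simp only [Function.comp_apply]
  rw [← Real.exp_add, ← Real.exp_nat_mul]
  congr 1
  push_cast
  ring

theorem memLp_exp_neg [IsGaussian μ] {U : X → EReal} (hU : IsProperLscConvex U)
    (hU_fin : ∀ᵐ x ∂μ, U x ≠ ⊤) (hV : AEStronglyMeasurable (fun x => (U x).toReal) μ) :
    MemLp (fun x => Real.exp (-(U x).toReal)) 2 μ := by
  obtain ⟨a', b, hab⟩ := hU.exists_affine_le
  refine (memLp_exp_dual (-a') (-b)).of_le
    (Real.continuous_exp.comp_aestronglyMeasurable hV.neg) ?_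
  filter_upwards [hU_fin] with x hx
  have h := hab x
  rw [← EReal.coe_toReal hx (hU.ne_bot x), EReal.coe_le_coe_iff] at h
  simp only [Real.norm_eq_abs, Real.abs_exp, neg_apply]
  exact Real.exp_le_exp.2 (by linarith)

end Weight

section Density

theorem weighted_eq {X : Type u} [MeasurableSpace X] {μ : Measure X} {U : X → EReal}
    (hbot : ∀ x, U x ≠ ⊥) (hU_fin : ∀ᵐ x ∂μ, U x ≠ ⊤) :
    weighted μ U = μ.withDensity fun x => ENNReal.ofReal (Real.exp (-(U x).toReal)) := by
  refine withDensity_congr_ae ?_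
  filter_upwards [hU_fin] with x hx
  conv_lhs => rw [← EReal.coe_toReal hx (hbot x)]
  rw [← EReal.coe_neg, EReal.exp_coe]

variable {X : Type*} [MeasurableSpace X] {μ : Measure X} {V : X → ℝ}

theorem integral_expDensity {F : Type*} [NormedAddCommGroup F] [NormedSpace ℝ F]
    (hV : AEStronglyMeasurable V μ) (f : X → F) :
    ∫ x, f x ∂(μ.withDensity fun x => ENNReal.ofReal (Real.exp (-V x))) =
      ∫ x, Real.exp (-V x) • f x ∂μ := by
  have hm : AEMeasurable (fun x => ENNReal.ofReal (Real.exp (-V x))) μ :=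
    (Real.continuous_exp.measurable.comp_aemeasurable hV.aemeasurable.neg).ennreal_ofReal
  rw [integral_withDensity_eq_integral_toReal_smul₀ hm (ae_of_all _ fun _ => by simp)]
  simp only [ENNReal.toReal_ofReal (Real.exp_pos _).le]

/-- By Hölder's inequality, `L⁴(μ) ⊆ L²(e^{-V} μ)` when `e^{-V} ∈ L²(μ)`. -/
theorem memLp_two_expDensity {F : Type*} [NormedAddCommGroup F]
    (hV : AEStronglyMeasurable V μ) (hE : MemLp (fun x => Real.exp (-V x)) 2 μ) {f : X → F}
    (hf : MemLp f 4 μ) :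
    MemLp f 2 (μ.withDensity fun x => ENNReal.ofReal (Real.exp (-V x))) := by
  have hm : AEMeasurable (fun x => ENNReal.ofReal (Real.exp (-V x))) μ :=
    (Real.continuous_exp.measurable.comp_aemeasurable hV.aemeasurable.neg).ennreal_ofReal
  have hfm : AEStronglyMeasurable f
      (μ.withDensity fun x => ENNReal.ofReal (Real.exp (-V x))) :=
    hf.aestronglyMeasurable.mono_ac (withDensity_absolutelyContinuous _ _)
  refine (memLp_two_iff_integrable_sq_norm hfm).2 ?_
  rw [integrable_withDensity_iff_integrable_smul₀' hm (ae_of_all _ fun _ => by simp)]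
  have h2 : MemLp (fun x => ‖f x‖ ^ 2) 2 μ := by
    have h3 := hf.norm_rpow_div 2
    have h4 : (4 : ℝ≥0∞) / 2 = 2 := by
      rw [show (4 : ℝ≥0∞) = 2 * 2 by norm_num, ENNReal.mul_div_cancel_right two_ne_zero (by simp)]
    rw [h4] at h3
    simpa using h3
  refine (hE.integrable_mul h2).congr (ae_of_all _ fun x => ?_)
  simp [ENNReal.toReal_ofReal (Real.exp_pos _).le]

end Density

/-! ### Integration by parts for the weighted measure -/

section WeightedIBP

/-- The bounded approximation `(e^s + ε)⁻¹` of `e^{-s}`. It increases to `e^{-s}` as `ε → 0+`,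
and so does the absolute value of its derivative. -/
noncomputable def regExp (ε s : ℝ) : ℝ := (Real.exp s + ε)⁻¹

theorem regExp_pos {ε : ℝ} (hε : 0 < ε) (s : ℝ) : 0 < regExp ε s :=
  inv_pos.2 (add_pos (Real.exp_pos s) hε)

theorem regExp_le_inv {ε : ℝ} (hε : 0 < ε) (s : ℝ) : regExp ε s ≤ ε⁻¹ :=
  inv_anti₀ hε (by linarith [Real.exp_pos s])

theorem regExp_le_exp {ε : ℝ} (hε : 0 < ε) (s : ℝ) : regExp ε s ≤ Real.exp (-s) := by
  rw [Real.exp_neg]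
  exact inv_anti₀ (Real.exp_pos s) (by linarith)

theorem mul_regExp_le_one {ε : ℝ} (hε : 0 < ε) (s : ℝ) : ε * regExp ε s ≤ 1 := by
  have h := mul_le_mul_of_nonneg_left (regExp_le_inv hε s) hε.le
  rwa [mul_inv_cancel₀ hε.ne'] at h

theorem norm_regExp_le {ε : ℝ} (hε : 0 < ε) (s : ℝ) : ‖regExp ε s‖ ≤ ε⁻¹ := by
  rw [Real.norm_of_nonneg (regExp_pos hε s).le]
  exact regExp_le_inv hε s

theorem contDiff_regExp {ε : ℝ} (hε : 0 < ε) : ContDiff ℝ 1 (regExp ε) :=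
  (Real.contDiff_exp.add contDiff_const).inv fun s => (add_pos (Real.exp_pos s) hε).ne'

theorem deriv_regExp {ε : ℝ} (hε : 0 < ε) (s : ℝ) :
    deriv (regExp ε) s = ε * regExp ε s ^ 2 - regExp ε s := by
  have h0 : Real.exp s + ε ≠ 0 := (add_pos (Real.exp_pos s) hε).ne'
  have h1 := ((Real.hasDerivAt_exp s).add_const ε).inv h0
  have h2 : deriv (regExp ε) s = -Real.exp s / (Real.exp s + ε) ^ 2 := h1.deriv
  rw [h2, regExp]
  field_simp
  ring

theorem norm_deriv_regExp_le {ε : ℝ} (hε : 0 < ε) (s : ℝ) :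
    ‖deriv (regExp ε) s‖ ≤ regExp ε s := by
  have h0 := regExp_pos hε s
  have h1 := mul_regExp_le_one hε s
  rw [deriv_regExp hε, Real.norm_eq_abs, abs_le]
  constructor
  · nlinarith [mul_nonneg hε.le (sq_nonneg (regExp ε s))]
  · nlinarith [mul_le_mul_of_nonneg_right h1 h0.le]

theorem norm_deriv_regExp_le_inv {ε : ℝ} (hε : 0 < ε) (s : ℝ) :
    ‖deriv (regExp ε) s‖ ≤ ε⁻¹ :=
  (norm_deriv_regExp_le hε s).trans (regExp_le_inv hε s)

theorem norm_regExp_sub_le {ε : ℝ} (hε : 0 < ε) (s t : ℝ) :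
    ‖regExp ε s - regExp ε t‖ ≤ ε⁻¹ * ‖s - t‖ :=
  convex_univ.norm_image_sub_le_of_norm_deriv_le
    (fun r _ => (contDiff_regExp hε).differentiable one_ne_zero r)
    (fun r _ => norm_deriv_regExp_le_inv hε r) (mem_univ t) (mem_univ s)

theorem norm_deriv_regExp_sub_le {ε : ℝ} (hε : 0 < ε) (s t : ℝ) :
    ‖deriv (regExp ε) s - deriv (regExp ε) t‖ ≤ ε⁻¹ * ‖s - t‖ := by
  -- the derivative is the polynomial `ε ρ² - ρ` of `ρ = regExp ε`, and `0 < ε ρ ≤ 1`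
  have e : deriv (regExp ε) s - deriv (regExp ε) t =
      (ε * regExp ε s + ε * regExp ε t - 1) * (regExp ε s - regExp ε t) := by
    rw [deriv_regExp hε, deriv_regExp hε]; ring
  rw [e, norm_mul]
  have h1 : ‖ε * regExp ε s + ε * regExp ε t - 1‖ ≤ 1 := by
    rw [Real.norm_eq_abs, abs_le]
    constructor
    · linarith [mul_pos hε (regExp_pos hε s), mul_pos hε (regExp_pos hε t)]
    · linarith [mul_regExp_le_one hε s, mul_regExp_le_one hε t]
  calc _ ≤ 1 * ‖regExp ε s - regExp ε t‖ := mul_le_mul_of_nonneg_right h1 (norm_nonneg _)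
    _ ≤ _ := by rw [one_mul]; exact norm_regExp_sub_le hε s t

theorem tendsto_regExp {ε : ℕ → ℝ} (hε : Tendsto ε atTop (𝓝 0)) (s : ℝ) :
    Tendsto (fun n => regExp (ε n) s) atTop (𝓝 (Real.exp (-s))) := by
  have h := (hε.const_add (Real.exp s)).inv₀ (by simp [Real.exp_ne_zero])
  rwa [add_zero, ← Real.exp_neg] at h

theorem tendsto_deriv_regExp {ε : ℕ → ℝ} (hε0 : ∀ n, 0 < ε n) (hε : Tendsto ε atTop (𝓝 0))
    (s : ℝ) : Tendsto (fun n => deriv (regExp (ε n)) s) atTop (𝓝 (-Real.exp (-s))) := by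
  have h := (hε.mul ((tendsto_regExp hε s).pow 2)).sub (tendsto_regExp hε s)
  rw [zero_mul, zero_sub] at h
  exact h.congr fun n => (deriv_regExp (hε0 n) s).symm

theorem tendsto_eLpNorm_zero_of_le {X E F : Type*} [MeasurableSpace X] [NormedAddCommGroup E]
    [NormedAddCommGroup F] {γ : Measure X} {p : ℝ≥0∞} {f : ℕ → X → E} {g : ℕ → X → F} {c : ℝ}
    (hfg : ∀ n x, ‖f n x‖ ≤ c * ‖g n x‖)
    (hg : Tendsto (fun n => eLpNorm (g n) p γ) atTop (𝓝 0)) :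
    Tendsto (fun n => eLpNorm (f n) p γ) atTop (𝓝 0) := by
  have h := ENNReal.Tendsto.const_mul (a := ENNReal.ofReal c) hg (Or.inr ENNReal.ofReal_ne_top)
  rw [mul_zero] at h
  exact tendsto_of_tendsto_of_tendsto_of_le_of_le tendsto_const_nhds h (fun _ => zero_le)
    fun n => eLpNorm_le_mul_eLpNorm_of_ae_le_mul (ae_of_all _ (hfg n)) p

variable {X : Type u} [NormedAddCommGroup X] [NormedSpace ℝ X] [MeasurableSpace X] [BorelSpace X]
  [SecondCountableTopology X] {γ : Measure X} [IsFiniteMeasure γ] {Q : NonnegSymmOp X}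
  {κ : RKHS Q} {β V : X → ℝ} {G : X → RKHS Q}

/-- Integration by parts for `w · (e^V + ε)⁻¹`, where `V` is a Sobolev function: the function
`s ↦ (e^s + ε)⁻¹` and its derivative are bounded and Lipschitz, so that `V` may be approximated by
cylindrical functions. -/
theorem HasDivergence.integral_regExp (hβ : HasDivergence Q γ κ β)
    (hV : HasSobolevGrad Q γ 2 V G) {w : X → ℝ} (hw : IsC1b w) {ε : ℝ} (hε : 0 < ε) :
    ∫ x, deriv (regExp ε) (V x) * (inner ℝ κ (G x) * w x) ∂γ =
      ∫ x, regExp ε (V x) * (β x * w x - inner ℝ κ (gradCyl Q w x)) ∂γ := by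
  obtain ⟨hV2, hG2, F, hF, hFV, hFG⟩ := hV
  have hFc : ∀ n, IsC1b (F n) := fun n => isC1b_of_mem_FCb (hF n)
  obtain ⟨C, hC⟩ := hw.bdd
  have hρ := contDiff_regExp hε
  have hρ' : Continuous (deriv (regExp ε)) := hρ.continuous_deriv le_rfl
  have hwm : AEStronglyMeasurable w γ := hw.continuous.aestronglyMeasurable
  have hm : MemLp (fun x => β x * w x - inner ℝ κ (gradCyl Q w x)) 2 γ := by
    refine MemLp.sub ?_ ((hw.memLp_gradCyl Q 2).const_inner κ)
    exact hβ.memLp.of_le_mul (hβ.memLp.aestronglyMeasurable.mul hwm)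
      (c := C) (ae_of_all _ fun x => by
        rw [norm_mul, mul_comm]; exact mul_le_mul_of_nonneg_right (hC x) (norm_nonneg _))
  have hρmem : ∀ {f : X → ℝ}, AEStronglyMeasurable f γ → MemLp (fun x => regExp ε (f x)) 2 γ :=
    fun hf => MemLp.of_bound (hρ.continuous.comp_aestronglyMeasurable hf) ε⁻¹
      (ae_of_all _ fun x => norm_regExp_le hε _)
  have hρmem' : ∀ {f : X → ℝ}, AEStronglyMeasurable f γ →
      MemLp (fun x => (deriv (regExp ε) (f x) * w x) • κ) 2 γ := fun hf =>
    MemLp.of_bound (((hρ'.comp_aestronglyMeasurable hf).mul hwm).smul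
      aestronglyMeasurable_const) (ε⁻¹ * C * ‖κ‖) (ae_of_all _ fun x => by
        rw [norm_smul, norm_mul]
        exact mul_le_mul_of_nonneg_right (mul_le_mul (norm_deriv_regExp_le_inv hε _) (hC x)
          (norm_nonneg _) (inv_nonneg.2 hε.le)) (norm_nonneg _))
  have hFm : ∀ n, AEStronglyMeasurable (F n) γ := fun n =>
    (hFc n).continuous.aestronglyMeasurable
  have h1 := tendsto_integral_inner (hρmem' hV2.aestronglyMeasurable) hG2
    (fun n => hρmem' (hFm n)) (fun n => (hFc n).memLp_gradCyl Q 2)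
    (tendsto_eLpNorm_zero_of_le (c := ε⁻¹ * C * ‖κ‖) (fun n x => by
      simp only [Pi.sub_apply]
      rw [← sub_smul, ← sub_mul, norm_smul, norm_mul]
      calc _ ≤ (ε⁻¹ * ‖F n x - V x‖) * C * ‖κ‖ :=
            mul_le_mul_of_nonneg_right (mul_le_mul (norm_deriv_regExp_sub_le hε _ _) (hC x)
              (norm_nonneg _) (by positivity)) (norm_nonneg _)
        _ = _ := by ring) hFV) hFG
  have h2 := tendsto_integral_inner hm (hρmem hV2.aestronglyMeasurable)
    (fun _ => hm) (fun n => hρmem (hFm n)) (by simp)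
    (tendsto_eLpNorm_zero_of_le (c := ε⁻¹) (fun n x => norm_regExp_sub_le hε _ _) hFV)
  -- integration by parts for the cylindrical approximations `w * regExp ε (F n)`
  have h3 : ∀ n, ∫ x, inner ℝ ((deriv (regExp ε) (F n x) * w x) • κ) (gradCyl Q (F n) x) ∂γ =
      ∫ x, inner ℝ (β x * w x - inner ℝ κ (gradCyl Q w x)) (regExp ε (F n x)) ∂γ := by
    intro n
    have hρF : IsC1b fun x => regExp ε (F n x) :=
      (hFc n).comp_real hρ ⟨_, norm_regExp_le hε⟩ ⟨_, norm_deriv_regExp_le_inv hε⟩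
    have h4 := hβ.integral_eq _ (hw.mul hρF)
    have h5 : ∀ x, inner ℝ κ (gradCyl Q (fun y => w y * regExp ε (F n y)) x) =
        inner ℝ ((deriv (regExp ε) (F n x) * w x) • κ) (gradCyl Q (F n) x) +
          inner ℝ κ (gradCyl Q w x) * regExp ε (F n x) := fun x => by
      rw [hw.gradCyl_mul hρF]
      have : gradCyl Q (fun y => regExp ε (F n y)) x =
          deriv (regExp ε) (F n x) • gradCyl Q (F n) x := by
        simp only [gradCyl, (hFc n).fderiv_comp_real hρ, map_smul]
      rw [this, inner_add_right, real_inner_smul_right, real_inner_smul_right,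
        real_inner_smul_right, real_inner_smul_left]
      ring
    have hI1 : Integrable (fun x => inner ℝ κ (gradCyl Q w x) * regExp ε (F n x)) γ :=
      ((hw.memLp_gradCyl Q 2).const_inner κ).integrable_mul (hρmem (hFm n))
    have hI2 : Integrable
        (fun x => inner ℝ ((deriv (regExp ε) (F n x) * w x) • κ) (gradCyl Q (F n) x)) γ := by
      have hi : Integrable
          (fun x => inner ℝ κ (gradCyl Q (fun y => w y * regExp ε (F n y)) x)) γ :=
        (((hw.mul hρF).memLp_gradCyl Q 2).const_inner κ).integrable one_le_two
      refine (hi.sub hI1).congr (ae_of_all _ fun x => ?_)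
      simp only [Pi.sub_apply, h5]
      ring
    have hI3 : Integrable (fun x => β x * (w x * regExp ε (F n x))) γ :=
      hβ.memLp.integrable_mul ((hw.mul hρF).memLp 2)
    simp only [h5] at h4
    rw [integral_add hI2 hI1] at h4
    rw [eq_sub_of_add_eq h4, ← integral_sub hI3 hI1]
    refine integral_congr_ae (ae_of_all _ fun x => ?_)
    simp
    ring
  simp only [h3] at h1
  have h4 := tendsto_nhds_unique h1 h2
  calc _ = ∫ x, inner ℝ ((deriv (regExp ε) (V x) * w x) • κ) (G x) ∂γ :=
        integral_congr_ae (ae_of_all _ fun x => by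
          simp only [real_inner_smul_left]; ring)
    _ = _ := h4
    _ = _ := integral_congr_ae (ae_of_all _ fun x => by simp)

/-- If `γ` has the divergence `β` along `κ`, then `e^{-V} γ` has the divergence
`β + [κ, D_H V]`. -/
theorem HasDivergence.expDensity (hβ : HasDivergence Q γ κ β)
    (hV : HasSobolevGrad Q γ 2 V G) (hE : MemLp (fun x => Real.exp (-V x)) 2 γ)
    (hβ4 : MemLp β 4 γ) (hG4 : MemLp G 4 γ) :
    HasDivergence Q (γ.withDensity fun x => ENNReal.ofReal (Real.exp (-V x))) κ
      (fun x => β x + inner ℝ κ (G x)) := by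
  have hVm : AEStronglyMeasurable V γ := hV.1.aestronglyMeasurable
  refine ⟨memLp_two_expDensity hVm hE (hβ4.add (hG4.const_inner κ)), fun w hw => ?_⟩
  obtain ⟨C, hC⟩ := hw.bdd
  have hwm : AEStronglyMeasurable w γ := hw.continuous.aestronglyMeasurable
  have hmulw : ∀ {f : X → ℝ}, MemLp f 2 γ → MemLp (fun x => f x * w x) 2 γ := fun hf =>
    hf.of_le_mul (hf.aestronglyMeasurable.mul hwm) (c := C) (ae_of_all _ fun x => by
      rw [norm_mul, mul_comm]; exact mul_le_mul_of_nonneg_right (hC x) (norm_nonneg _))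
  have hm : MemLp (fun x => β x * w x - inner ℝ κ (gradCyl Q w x)) 2 γ :=
    (hmulw hβ.memLp).sub ((hw.memLp_gradCyl Q 2).const_inner κ)
  have hg : MemLp (fun x => inner ℝ κ (G x) * w x) 2 γ := hmulw (hV.2.1.const_inner κ)
  let ε : ℕ → ℝ := fun n => 1 / ((n : ℝ) + 1)
  have hε0 : ∀ n, 0 < ε n := fun n => by positivity
  have hε : Tendsto ε atTop (𝓝 0) := tendsto_one_div_add_atTop_nhds_zero_nat
  have h1 : Tendsto (fun n => ∫ x, regExp (ε n) (V x) *
      (β x * w x - inner ℝ κ (gradCyl Q w x)) ∂γ) atTop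
      (𝓝 (∫ x, Real.exp (-V x) * (β x * w x - inner ℝ κ (gradCyl Q w x)) ∂γ)) := by
    refine tendsto_integral_of_dominated_convergence
      (fun x => ‖Real.exp (-V x) * (β x * w x - inner ℝ κ (gradCyl Q w x))‖)
      (fun n => ((contDiff_regExp (hε0 n)).continuous.comp_aestronglyMeasurable hVm).mul
        hm.aestronglyMeasurable) (hE.integrable_mul hm).norm
      (fun n => ae_of_all _ fun x => ?_)
      (ae_of_all _ fun x => (tendsto_regExp hε (V x)).mul_const _)
    rw [norm_mul, norm_mul]
    refine mul_le_mul_of_nonneg_right ?_ (norm_nonneg _)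
    rw [Real.norm_of_nonneg (regExp_pos (hε0 n) _).le, Real.norm_of_nonneg (Real.exp_pos _).le]
    exact regExp_le_exp (hε0 n) _
  have h2 : Tendsto (fun n => ∫ x, deriv (regExp (ε n)) (V x) * (inner ℝ κ (G x) * w x) ∂γ) atTop
      (𝓝 (∫ x, -Real.exp (-V x) * (inner ℝ κ (G x) * w x) ∂γ)) := by
    refine tendsto_integral_of_dominated_convergence
      (fun x => ‖Real.exp (-V x) * (inner ℝ κ (G x) * w x)‖)
      (fun n => (((contDiff_regExp (hε0 n)).continuous_deriv le_rfl).comp_aestronglyMeasurable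
        hVm).mul hg.aestronglyMeasurable) (hE.integrable_mul hg).norm
      (fun n => ae_of_all _ fun x => ?_)
      (ae_of_all _ fun x => (tendsto_deriv_regExp hε0 hε (V x)).mul_const _)
    rw [norm_mul, norm_mul (Real.exp _)]
    refine mul_le_mul_of_nonneg_right ?_ (norm_nonneg _)
    rw [Real.norm_of_nonneg (Real.exp_pos _).le]
    exact (norm_deriv_regExp_le (hε0 n) _).trans (regExp_le_exp (hε0 n) _)
  simp only [fun n => hβ.integral_regExp hV hw (hε0 n)] at h2
  have h3 := tendsto_nhds_unique h2 h1
  have hIw : Integrable (fun x => Real.exp (-V x) * inner ℝ κ (gradCyl Q w x)) γ :=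
    hE.integrable_mul ((hw.memLp_gradCyl Q 2).const_inner κ)
  have hIg : Integrable (fun x => -Real.exp (-V x) * (inner ℝ κ (G x) * w x)) γ :=
    hE.neg.integrable_mul hg
  have hIm : Integrable
      (fun x => Real.exp (-V x) * (β x * w x - inner ℝ κ (gradCyl Q w x))) γ :=
    hE.integrable_mul hm
  have hId : Integrable
      (fun x => Real.exp (-V x) * (β x * w x - inner ℝ κ (gradCyl Q w x)) -
        -Real.exp (-V x) * (inner ℝ κ (G x) * w x)) γ := hIm.sub hIg
  rw [integral_expDensity hVm, integral_expDensity hVm]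
  simp only [smul_eq_mul]
  calc _ = (∫ x, Real.exp (-V x) * (β x * w x - inner ℝ κ (gradCyl Q w x)) ∂γ) -
        (∫ x, -Real.exp (-V x) * (inner ℝ κ (G x) * w x) ∂γ) +
        ∫ x, Real.exp (-V x) * inner ℝ κ (gradCyl Q w x) ∂γ := by rw [h3, sub_self, zero_add]
    _ = ∫ x, (Real.exp (-V x) * (β x * w x - inner ℝ κ (gradCyl Q w x)) -
        -Real.exp (-V x) * (inner ℝ κ (G x) * w x) +
        Real.exp (-V x) * inner ℝ κ (gradCyl Q w x)) ∂γ := by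
          rw [integral_add hId hIw, integral_sub hIm hIg]
    _ = _ := integral_congr_ae (ae_of_all _ fun x => by ring)

end WeightedIBP

/-! ### Derivatives of cylindrical functions -/

section Cylindrical

variable {X : Type u} [NormedAddCommGroup X] [NormedSpace ℝ X] {n : ℕ}
  {φ : (Fin n → ℝ) → ℝ}

/-- The partial derivative `∂ⱼ φ`. -/
noncomputable def pderiv (j : Fin n) (φ : (Fin n → ℝ) → ℝ) (ξ : Fin n → ℝ) : ℝ :=
  fderiv ℝ φ ξ (Pi.single j 1)

theorem IsCb.of_le {k l : ℕ} (hkl : k ≤ l) (hφ : IsCb l φ) : IsCb k φ :=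
  ⟨hφ.1.of_le (by exact_mod_cast hkl), fun j hj => hφ.2 j (hj.trans hkl)⟩

theorem FCb1_two_subset_FCb {A : X →ₗ.[ℝ] X} : FCb1 A 2 ⊆ FCb X 1 := by
  rintro f ⟨n, φ, x', hφ, -, hf⟩
  exact ⟨n, φ, x', hφ.of_le one_le_two, fun _ => mem_univ _, hf⟩

theorem hasFDerivAt_pderiv (hφ : ContDiff ℝ 2 φ) (j : Fin n) (ξ : Fin n → ℝ) :
    HasFDerivAt (pderiv j φ) ((fderiv ℝ (fderiv ℝ φ) ξ).flip (Pi.single j 1)) ξ := by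
  have h1 : ContDiff ℝ 1 (fderiv ℝ φ) := hφ.fderiv_right (by norm_num)
  have h2 := (h1.differentiable one_ne_zero ξ).hasFDerivAt.clm_apply
    (hasFDerivAt_const (Pi.single j (1 : ℝ) : Fin n → ℝ) ξ)
  refine h2.congr_fderiv ?_
  ext z
  simp

theorem IsCb.isC1b_pderiv (hφ : IsCb 2 φ) (j : Fin n) : IsC1b (pderiv j φ) := by
  obtain ⟨C, hC⟩ := hφ.2 1 one_le_two
  obtain ⟨D, hD⟩ := hφ.2 2 le_rfl
  have hφ2 : ContDiff ℝ 2 φ := hφ.1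
  have h1 : ContDiff ℝ 1 (fderiv ℝ φ) := hφ2.fderiv_right (by norm_num)
  refine ⟨h1.clm_apply contDiff_const, ⟨C * ‖(Pi.single j 1 : Fin n → ℝ)‖, fun ξ => ?_⟩,
    ⟨D * ‖(Pi.single j 1 : Fin n → ℝ)‖, fun ξ => ?_⟩⟩
  · exact (fderiv ℝ φ ξ).le_of_opNorm_le (by simpa [norm_iteratedFDeriv_one] using hC ξ) _
  · rw [(hasFDerivAt_pderiv hφ2 j ξ).fderiv]
    refine ContinuousLinearMap.le_of_opNorm_le _ ?_ _
    rw [ContinuousLinearMap.opNorm_flip, ← norm_iteratedFDeriv_one, norm_iteratedFDeriv_fderiv]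
    exact hD ξ

theorem pderiv_comm (hφ : ContDiff ℝ 2 φ) (i j : Fin n) (ξ : Fin n → ℝ) :
    pderiv i (pderiv j φ) ξ = pderiv j (pderiv i φ) ξ := by
  have h : IsSymmSndFDerivAt ℝ φ ξ := hφ.contDiffAt.isSymmSndFDerivAt (by simp)
  rw [pderiv, pderiv, (hasFDerivAt_pderiv hφ j ξ).fderiv, (hasFDerivAt_pderiv hφ i ξ).fderiv]
  exact h _ _

theorem fderiv_cylindrical (hφ : Differentiable ℝ φ) (x' : Fin n → StrongDual ℝ X) (x : X) :
    fderiv ℝ (fun y => φ fun i => x' i y) x = ∑ j, pderiv j φ (fun i => x' i x) • x' j := by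
  have h : HasFDerivAt (fun y => φ (ContinuousLinearMap.pi x' y))
      ((fderiv ℝ φ (ContinuousLinearMap.pi x' x)).comp (ContinuousLinearMap.pi x')) x :=
    (hφ _).hasFDerivAt.comp x (ContinuousLinearMap.pi x').hasFDerivAt
  refine h.fderiv.trans ?_
  ext z
  have hz : ContinuousLinearMap.pi x' z = ∑ j, x' j z • (Pi.single j 1 : Fin n → ℝ) := by
    rw [← Finset.univ_sum_single (ContinuousLinearMap.pi x' z)]
    refine Finset.sum_congr rfl fun j _ => ?_
    rw [← Pi.single_smul']
    simp
  rw [ContinuousLinearMap.comp_apply, hz, map_sum, sum_apply]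
  refine Finset.sum_congr rfl fun j _ => ?_
  rw [map_smul, smul_apply, smul_eq_mul, smul_eq_mul, mul_comm]
  rfl

theorem gradCyl_cylindrical (Q : NonnegSymmOp X) (hφ : Differentiable ℝ φ)
    (x' : Fin n → StrongDual ℝ X) (x : X) :
    gradCyl Q (fun y => φ fun i => x' i y) x =
      ∑ j, pderiv j φ (fun i => x' i x) • istar Q (x' j) := by
  rw [gradCyl, fderiv_cylindrical hφ, map_sum]
  simp only [map_smul]

variable [CompleteSpace X]

theorem hessCyl_cylindrical (Q : NonnegSymmOp X) (hφ : IsCb 2 φ) (x' : Fin n → StrongDual ℝ X)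
    (x : X) (h k : RKHS Q) :
    hessCyl Q (fun y => φ fun i => x' i y) x h k =
      ∑ j, ∑ i, pderiv i (pderiv j φ) (fun i => x' i x) *
        (inner ℝ h (istar Q (x' i)) * inner ℝ k (istar Q (x' j))) := by
  have h1 : fderiv ℝ (fun y => φ fun i => x' i y) =
      fun y => ∑ j, pderiv j φ (fun i => x' i y) • x' j :=
    funext fun y => fderiv_cylindrical (hφ.isC1b one_le_two).differentiable x' y
  have h2 : ∀ j, HasFDerivAt (fun y => pderiv j φ (fun i => x' i y) • x' j)
      ((∑ i, pderiv i (pderiv j φ) (fun i => x' i x) • x' i).smulRight (x' j)) x := by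
    intro j
    have h3 := (((hφ.isC1b_pderiv j).comp_clm (ContinuousLinearMap.pi x')).differentiable
      x).hasFDerivAt
    have h4 := fderiv_cylindrical (hφ.isC1b_pderiv j).differentiable x' x
    have h5 : HasFDerivAt (fun y => pderiv j φ fun i => x' i y)
      (∑ i, pderiv i (pderiv j φ) (fun i => x' i x) • x' i) x := by
      rw [← h4]
      exact h3
    exact h5.smul_const (x' j)
  have h6 := (HasFDerivAt.fun_sum fun j (_ : j ∈ Finset.univ) => h2 j).fderiv
  rw [hessCyl, h1, ContinuousLinearMap.bilinearComp_apply, h6, sum_apply, sum_apply]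
  refine Finset.sum_congr rfl fun j _ => ?_
  rw [ContinuousLinearMap.smulRight_apply, smul_apply, sum_apply, Finset.sum_smul]
  refine Finset.sum_congr rfl fun i _ => ?_
  rw [smul_apply, inner_istar, inner_istar]
  simp only [smul_eq_mul]
  ring

end Cylindrical

/-! ### Traces of bilinear forms of finite rank -/

section Trace

variable {H : Type u} [NormedAddCommGroup H] [InnerProductSpace ℝ H]

theorem hasSum_finiteRank {n : ℕ} {Φ : H →L[ℝ] H →L[ℝ] ℝ} {c : Fin n → Fin n → ℝ}
    {a : Fin n → H} (hΦ : ∀ h k, Φ h k = ∑ j, ∑ i, c j i * (inner ℝ h (a i) * inner ℝ k (a j)))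
    {ι : Type*} (b : HilbertBasis ι ℝ H) :
    HasSum (fun m => Φ (b m) (b m)) (∑ j, ∑ i, c j i * inner ℝ (a i) (a j)) := by
  simp only [hΦ]
  refine hasSum_sum fun j _ => hasSum_sum fun i _ => ?_
  refine HasSum.mul_left _ ?_
  refine (b.hasSum_inner_mul_inner (a i) (a j)).congr_fun fun m => ?_
  rw [real_inner_comm]

theorem formTrace_finiteRank [CompleteSpace H] {n : ℕ} {Φ : H →L[ℝ] H →L[ℝ] ℝ}
    {c : Fin n → Fin n → ℝ} {a : Fin n → H}
    (hΦ : ∀ h k, Φ h k = ∑ j, ∑ i, c j i * (inner ℝ h (a i) * inner ℝ k (a j))) :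
    formTrace Φ = ∑ j, ∑ i, c j i * inner ℝ (a i) (a j) := by
  obtain ⟨b, hb⟩ := (exists_hilbertBasis ℝ H).choose_spec
  have h := (hasSum_finiteRank hΦ b).tsum_eq
  simp only [hb] at h
  exact h

end Trace

section TraceCyl

variable {X : Type u} [NormedAddCommGroup X] [NormedSpace ℝ X] [CompleteSpace X] {n : ℕ}
  {φ : (Fin n → ℝ) → ℝ} {T : ℝ → X →L[ℝ] X} {A : X →ₗ.[ℝ] X}

theorem formTrace_hessCyl (Q : NonnegSymmOp X) (hφ : IsCb 2 φ) (x' : Fin n → StrongDual ℝ X)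
    (x : X) :
    formTrace (hessCyl Q (fun y => φ fun i => x' i y) x) =
      ∑ j, ∑ i, pderiv i (pderiv j φ) (fun i => x' i x) *
        inner ℝ (istar Q (x' i)) (istar Q (x' j)) :=
  formTrace_finiteRank (hessCyl_cylindrical Q hφ x' x)

/-- The symmetric part of `B` is `-I / 2`, so that `B` contributes half of the trace to the
divergence of `B D_H u`. -/
theorem sum_inner_opB_gradCyl {Q : NonnegSymmOp X} (hT : IsC0ContractionSemigroup T)
    (hA : IsGenerator A T) {Qinf : StrongDual ℝ X →L[ℝ] X}
    (hQinf : ∀ x' y' : StrongDual ℝ X,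
      Tendsto (fun t : ℝ => y' (covInt Q T t x')) atTop (𝓝 (y' (Qinf x'))))
    (hsymm : ∀ x' y' : StrongDual ℝ X, y' (Qinf x') = x' (Qinf y'))
    {B : RKHS Q →L[ℝ] RKHS Q}
    (hB : ∀ x' ∈ adjDomain A, emb Q (B (istar Q x')) = Qinf (adj A x'))
    (hφ : IsCb 2 φ) {x' : Fin n → StrongDual ℝ X} (hx' : ∀ j, x' j ∈ adjDomain A) (x : X) :
    ∑ j, inner ℝ (B (istar Q (x' j))) (gradCyl Q (fun y => pderiv j φ fun i => x' i y) x) =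
      -(1 / 2 * formTrace (hessCyl Q (fun y => φ fun i => x' i y) x)) := by
  have hφ2 : ContDiff ℝ 2 φ := hφ.1
  let c : Fin n → Fin n → ℝ := fun j i => pderiv i (pderiv j φ) fun i => x' i x
  have hcs : ∀ i j, c i j = c j i := fun i j => pderiv_comm hφ2 _ _ _
  have h1 : ∀ j, inner ℝ (B (istar Q (x' j)))
      (gradCyl Q (fun y => pderiv j φ fun i => x' i y) x) =
      ∑ i, c j i * x' i (Qinf (adj A (x' j))) := by
    intro j
    rw [gradCyl_cylindrical Q (hφ.isC1b_pderiv j).differentiable, inner_sum]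
    refine Finset.sum_congr rfl fun i _ => ?_
    rw [real_inner_smul_right, inner_istar, hB _ (hx' j)]
  -- symmetrise in `i` and `j`, then use the Lyapunov equation
  have h2 : ∑ j, ∑ i, c j i * x' i (Qinf (adj A (x' j))) =
      ∑ j, ∑ i, c j i * x' j (Qinf (adj A (x' i))) := by
    rw [Finset.sum_comm]
    exact Finset.sum_congr rfl fun i _ => Finset.sum_congr rfl fun j _ => by rw [hcs]
  have h3 : ∑ j, ∑ i, c j i * x' i (Qinf (adj A (x' j))) +
      ∑ j, ∑ i, c j i * x' j (Qinf (adj A (x' i))) =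
      -∑ j, ∑ i, c j i * inner ℝ (istar Q (x' i)) (istar Q (x' j)) := by
    rw [← Finset.sum_add_distrib, ← Finset.sum_neg_distrib]
    refine Finset.sum_congr rfl fun j _ => ?_
    rw [← Finset.sum_add_distrib, ← Finset.sum_neg_distrib]
    refine Finset.sum_congr rfl fun i _ => ?_
    rw [inner_istar_istar, hsymm _ (x' i), hsymm _ (x' j), ← mul_add,
      add_comm, lyapunov Q hT hA hQinf (hx' i) (hx' j)]
    ring
  rw [formTrace_hessCyl Q hφ, Finset.sum_congr rfl fun j _ => h1 j]
  rw [← h2] at h3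
  linarith

end TraceCyl

/-! ### The operator `L₂` on cylindrical functions -/

section L2

variable {X : Type u} [NormedAddCommGroup X] [NormedSpace ℝ X] [MeasurableSpace X] [BorelSpace X]
  [SecondCountableTopology X]

/-- The divergence of the field `∑ⱼ ψⱼ κⱼ`. -/
theorem integral_sum_smul_divergence {γ : Measure X} [IsFiniteMeasure γ] {Q : NonnegSymmOp X}
    {n : ℕ} {κ : Fin n → RKHS Q} {β : Fin n → X → ℝ} (hβ : ∀ j, HasDivergence Q γ (κ j) (β j))
    {ψ : Fin n → X → ℝ} (hψ : ∀ j, IsC1b (ψ j)) :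
    MemLp (fun x => ∑ j, (β j x * ψ j x - inner ℝ (κ j) (gradCyl Q (ψ j) x))) 2 γ ∧
      ∀ v ∈ FCb X 1, ∫ x, inner ℝ (∑ j, ψ j x • κ j) (gradCyl Q v x) ∂γ =
        ∫ x, (∑ j, (β j x * ψ j x - inner ℝ (κ j) (gradCyl Q (ψ j) x))) * v x ∂γ := by
  have hm : ∀ j, MemLp (fun x => β j x * ψ j x - inner ℝ (κ j) (gradCyl Q (ψ j) x)) 2 γ := by
    intro j
    obtain ⟨C, hC⟩ := (hψ j).bdd
    refine MemLp.sub ?_ (((hψ j).memLp_gradCyl Q 2).const_inner _)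
    exact (hβ j).memLp.of_le_mul
      ((hβ j).memLp.aestronglyMeasurable.mul (hψ j).continuous.aestronglyMeasurable)
      (c := C) (ae_of_all _ fun x => by
        rw [norm_mul, mul_comm]; exact mul_le_mul_of_nonneg_right (hC x) (norm_nonneg _))
  refine ⟨memLp_finsetSum _ fun j _ => hm j, fun v hv => ?_⟩
  have hv' := isC1b_of_mem_FCb hv
  have hI1 : ∀ j ∈ Finset.univ,
      Integrable (fun x => inner ℝ (κ j) (gradCyl Q v x) * ψ j x) γ := fun j _ =>
    ((hv'.memLp_gradCyl Q 2).const_inner _).integrable_mul ((hψ j).memLp 2)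
  have hI2 : ∀ j ∈ Finset.univ, Integrable
      (fun x => (β j x * ψ j x - inner ℝ (κ j) (gradCyl Q (ψ j) x)) * v x) γ := fun j _ =>
    (hm j).integrable_mul (hv'.memLp 2)
  calc _ = ∫ x, ∑ j, inner ℝ (κ j) (gradCyl Q v x) * ψ j x ∂γ :=
        integral_congr_ae (ae_of_all _ fun x => by
          simp only [sum_inner, real_inner_smul_left, mul_comm])
    _ = ∫ x, ∑ j, (β j x * ψ j x - inner ℝ (κ j) (gradCyl Q (ψ j) x)) * v x ∂γ := by
        rw [integral_finsetSum _ hI1, integral_finsetSum _ hI2]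
        exact Finset.sum_congr rfl fun j _ =>
          (hβ j).integral_sobolev (hasSobolevGrad_of_mem_FCb Q 2 hv) (hψ j)
    _ = _ := by simp only [Finset.sum_mul]

variable [CompleteSpace X]

/-- The value `L₂ u` is unique up to null sets. -/
theorem opL2_ae_eq {Q : NonnegSymmOp X} {B : RKHS Q →L[ℝ] RKHS Q} {γ : Measure X}
    [IsFiniteMeasure γ] {u g : X → ℝ} (hg : IsL2Value Q B γ u g) : opL2 Q B γ u =ᵐ[γ] g := by
  have hu : u ∈ domL2 Q B γ := ⟨g, hg⟩
  have h : IsL2Value Q B γ u (opL2 Q B γ u) := by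
    rw [opL2, dif_pos hu]
    exact Classical.choose_spec hu
  have h0 : opL2 Q B γ u - g =ᵐ[γ] 0 := by
    refine ae_eq_zero_of_forall_FCb ((h.2.1.sub hg.2.1).integrable one_le_two) fun v hv => ?_
    have hv' := (isC1b_of_mem_FCb hv).memLp (γ := γ) 2
    have h1 : Integrable (fun x => opL2 Q B γ u x * v x) γ := h.2.1.integrable_mul hv'
    have h2 : Integrable (fun x => g x * v x) γ := hg.2.1.integrable_mul hv'
    simp only [Pi.sub_apply, sub_mul]
    rw [integral_sub h1 h2, sub_eq_zero]
    exact neg_injective ((h.2.2 v hv).symm.trans (hg.2.2 v hv))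
  filter_upwards [h0] with x hx
  exact sub_eq_zero.1 hx

/-- `⟨·, y'⟩` is the divergence along `κ` for the Gaussian measure with covariance `R` when
`i κ = R y'`. -/
theorem hasDivergence_gaussian {μ : Measure X} {R : StrongDual ℝ X →L[ℝ] X}
    (hμ : IsCentredGaussian μ R) (hnd : ∀ x' : StrongDual ℝ X, x' ≠ 0 → 0 < x' (R x'))
    {Q : NonnegSymmOp X} {κ : RKHS Q} {y' : StrongDual ℝ X} (hκ : emb Q κ = R y') :
    HasDivergence Q μ κ y' := by
  have := hμ.gaussian
  refine ⟨ProbabilityTheory.IsGaussian.memLp_dual μ y' 2 (by simp), fun w hw => ?_⟩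
  have h1 : ∀ x, inner ℝ κ (gradCyl Q w x) = fderiv ℝ w x (R y') := fun x => by
    rw [gradCyl, inner_istar, hκ]
  simp only [h1]
  by_cases hy : y' = 0
  · simp [hy]
  · exact (integral_dual_mul hμ (hnd y' hy) hw).symm

end L2

end PerturbedOU

theorem mainTheorem4 {X : Type*} [NormedAddCommGroup X] [NormedSpace ℝ X] [CompleteSpace X]
    [TopologicalSpace.SeparableSpace X] [MeasurableSpace X] [BorelSpace X]
    (Q : PerturbedOU.NonnegSymmOp X)
    (A : X →ₗ.[ℝ] X) (T : ℝ → X →L[ℝ] X)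
    (hT : PerturbedOU.IsC0ContractionSemigroup T) (hA : PerturbedOU.IsGenerator A T)
    -- `Q_t` is the covariance operator of a centred Gaussian measure
    (hQt : ∀ t : ℝ, 0 < t →
      ∃ μt : Measure X, PerturbedOU.IsCentredGaussian μt (PerturbedOU.covInt Q T t))
    -- `Q_t x'` converges weakly to `Q_∞ x'`, `Q_∞` being the covariance operator of the
    -- centred nondegenerate Gaussian measure `μ_∞`
    (Qinf : StrongDual ℝ X →L[ℝ] X) (μ : Measure X)
    (hQinf : ∀ x' y' : StrongDual ℝ X,
      Tendsto (fun t : ℝ => y' (PerturbedOU.covInt Q T t x')) atTop (𝓝 (y' (Qinf x'))))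
    (hμ : PerturbedOU.IsCentredGaussian μ Qinf)
    (hμ_nondeg : ∀ x' : StrongDual ℝ X, x' ≠ 0 → 0 < x' (Qinf x'))
    -- `Q_∞ A* x' ∈ H` and `|Q_∞ A* x'|_H ≤ c |i* x'|_H` on `D(A*)`
    (hRKH : ∃ c : ℝ, 0 < c ∧ ∀ x' ∈ PerturbedOU.adjDomain A, ∃ h : PerturbedOU.RKHS Q,
      PerturbedOU.emb Q h = Qinf (PerturbedOU.adj A x') ∧ ‖h‖ ≤ c * ‖PerturbedOU.istar Q x'‖)
    -- the weight `U`
    (U : X → EReal) (hU : PerturbedOU.IsProperLscConvex U)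
    (hU_fin : ∀ᵐ x ∂μ, U x ≠ ⊤)
    (hU_sob : ∀ p : ℝ, 1 ≤ p →
      PerturbedOU.MemSobolev Q μ (ENNReal.ofReal p) (fun x => (U x).toReal)) :
    PerturbedOU.FCb1 A 2 ⊆
        PerturbedOU.domL2 Q (PerturbedOU.opB Q A Qinf) (PerturbedOU.weighted μ U) ∧
      ∀ u ∈ PerturbedOU.FCb1 A 2,
        -- `D_H² u(x)` is of trace class, with the same trace in every orthonormal basis
        (∀ (x : X) {ι : Type*} (b : HilbertBasis ι ℝ (PerturbedOU.RKHS Q)),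
          HasSum (fun n => PerturbedOU.hessCyl Q u x (b n) (b n))
            (PerturbedOU.formTrace (PerturbedOU.hessCyl Q u x))) ∧
        PerturbedOU.opL2 Q (PerturbedOU.opB Q A Qinf) (PerturbedOU.weighted μ U) u
          =ᵐ[PerturbedOU.weighted μ U] fun x =>
            1 / 2 * PerturbedOU.formTrace (PerturbedOU.hessCyl Q u x)
              + PerturbedOU.adj A (fderiv ℝ u x) x
              + inner ℝ (PerturbedOU.opB Q A Qinf (PerturbedOU.gradCyl Q u x))
                  (PerturbedOU.sobolevGrad Q μ 2 (fun y => (U y).toReal) x) := by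
  have : SecondCountableTopology X := UniformSpace.secondCountable_of_separable X
  have := hμ.gaussian
  have hd := hA.dense_domain hT
  have hB := PerturbedOU.emb_opB_istar Q hT hA Qinf hRKH
  set B := PerturbedOU.opB Q A Qinf
  -- the Gaussian measure has divergences along the dense set `B i* D(A*)`
  have hdense := PerturbedOU.denseRange_opB_istar (Q := Q) hT hA
    (PerturbedOU.inner_opB_self hT hA hQinf hμ.symm hB)
  have hdivμ : ∀ x' ∈ PerturbedOU.adjDomain A,
      PerturbedOU.HasDivergence Q μ (B (PerturbedOU.istar Q x')) (PerturbedOU.adj A x') :=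
    fun x' hx' => PerturbedOU.hasDivergence_gaussian hμ hμ_nondeg (hB x' hx')
  -- the gradients of `U` for `p = 2` and `p = 4` agree, so the former is in `L⁴`
  set V : X → ℝ := fun y => (U y).toReal
  have hV2 : PerturbedOU.MemSobolev Q μ 2 V := by
    have h := hU_sob 2 one_le_two
    rwa [show ENNReal.ofReal 2 = 2 by norm_num] at h
  have hG := PerturbedOU.sobolevGrad_spec hV2
  set G := PerturbedOU.sobolevGrad Q μ 2 V
  have hG4 : MemLp G 4 μ := by
    have h := hU_sob 4 (by norm_num)
    rw [show ENNReal.ofReal 4 = 4 by norm_num] at h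
    obtain ⟨K, hK⟩ := h
    exact hK.2.1.ae_eq (PerturbedOU.HasSobolevGrad.ae_unique hdense
      (fun x' => ⟨_, hdivμ x' x'.2⟩) (hK.mono_exponent (by norm_num)) hG)
  have hVm : AEStronglyMeasurable V μ := hG.1.aestronglyMeasurable
  have hE : MemLp (fun x => Real.exp (-V x)) 2 μ := PerturbedOU.memLp_exp_neg hU hU_fin hVm
  rw [PerturbedOU.weighted_eq hU.ne_bot hU_fin]
  set ν := μ.withDensity fun x => ENNReal.ofReal (Real.exp (-(U x).toReal))
  have : IsFiniteMeasure ν :=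
    isFiniteMeasure_withDensity_ofReal (hE.integrable one_le_two).hasFiniteIntegral
  have hdivν : ∀ x' ∈ PerturbedOU.adjDomain A,
      PerturbedOU.HasDivergence Q ν (B (PerturbedOU.istar Q x'))
        (fun x => PerturbedOU.adj A x' x + inner ℝ (B (PerturbedOU.istar Q x')) (G x)) :=
    fun x' hx' => (hdivμ x' hx').expDensity hG hE
      (ProbabilityTheory.IsGaussian.memLp_dual μ _ 4 (by simp)) hG4
  -- on cylindrical functions the closed gradient is the classical one
  have hgrad : ∀ v ∈ PerturbedOU.FCb X 1,
      PerturbedOU.sobolevGrad Q ν 2 v =ᵐ[ν] PerturbedOU.gradCyl Q v := fun v hv =>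
    have h := PerturbedOU.hasSobolevGrad_of_mem_FCb (γ := ν) Q 2 hv
    PerturbedOU.HasSobolevGrad.ae_unique hdense (fun x' => ⟨_, hdivν x' x'.2⟩)
      (PerturbedOU.sobolevGrad_spec ⟨_, h⟩) h
  have key : ∀ u ∈ PerturbedOU.FCb1 A 2, PerturbedOU.IsL2Value Q B ν u fun x =>
      1 / 2 * PerturbedOU.formTrace (PerturbedOU.hessCyl Q u x)
        + PerturbedOU.adj A (fderiv ℝ u x) x
        + inner ℝ (B (PerturbedOU.gradCyl Q u x)) (G x) := by
    intro u hu
    have huF := PerturbedOU.FCb1_two_subset_FCb hu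
    obtain ⟨n, φ, x', hφ, hx', hux⟩ := hu
    obtain rfl : u = fun x => φ fun i => x' i x := funext hux
    have hφd := (hφ.isC1b one_le_two).differentiable
    have hψ : ∀ j, PerturbedOU.IsC1b fun x => PerturbedOU.pderiv j φ fun i => x' i x := fun j =>
      (hφ.isC1b_pderiv j).comp_clm (ContinuousLinearMap.pi x')
    obtain ⟨hm, hform⟩ := PerturbedOU.integral_sum_smul_divergence
      (fun j => hdivν (x' j) (hx' j)) hψ
    have hval : ∀ x, ∑ j, ((PerturbedOU.adj A (x' j) x +
        inner ℝ (B (PerturbedOU.istar Q (x' j))) (G x)) * PerturbedOU.pderiv j φ (fun i => x' i x) -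
        inner ℝ (B (PerturbedOU.istar Q (x' j)))
          (PerturbedOU.gradCyl Q (fun x => PerturbedOU.pderiv j φ fun i => x' i x) x)) =
        1 / 2 * PerturbedOU.formTrace (PerturbedOU.hessCyl Q (fun x => φ fun i => x' i x) x)
          + PerturbedOU.adj A (fderiv ℝ (fun x => φ fun i => x' i x) x) x
          + inner ℝ (B (PerturbedOU.gradCyl Q (fun x => φ fun i => x' i x) x)) (G x) := by
      intro x
      rw [Finset.sum_sub_distrib,
        PerturbedOU.sum_inner_opB_gradCyl hT hA hQinf hμ.symm hB hφ hx' x,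
        PerturbedOU.fderiv_cylindrical hφd, PerturbedOU.adj_sum_smul hd _ hx',
        PerturbedOU.gradCyl_cylindrical Q hφd, map_sum, sum_inner, sum_apply, sub_neg_eq_add,
        add_comm, add_assoc, ← Finset.sum_add_distrib]
      congr 1
      refine Finset.sum_congr rfl fun j _ => ?_
      rw [map_smul, real_inner_smul_left, smul_apply, smul_eq_mul]
      ring
    simp only [hval] at hm hform
    refine ⟨⟨_, PerturbedOU.hasSobolevGrad_of_mem_FCb Q 2 huF⟩, hm, fun v hv => ?_⟩
    rw [PerturbedOU.form, ← hform v hv]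
    congr 1
    refine integral_congr_ae ?_
    filter_upwards [hgrad _ huF, hgrad v hv] with x h1 h2
    rw [h1, h2, PerturbedOU.gradCyl_cylindrical Q hφd, map_sum]
    simp only [map_smul]
  refine ⟨fun u hu => ⟨_, key u hu⟩, fun u hu => ⟨fun x ι b => ?_, ?_⟩⟩
  · obtain ⟨n, φ, x', hφ, -, hux⟩ := hu
    obtain rfl : u = fun x => φ fun i => x' i x := funext hux
    rw [PerturbedOU.formTrace_hessCyl Q hφ]
    exact PerturbedOU.hasSum_finiteRank (PerturbedOU.hessCyl_cylindrical Q hφ x' x) b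
  · exact PerturbedOU.opL2_ae_eq (key u hu)
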